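/- **Model.** Let $N,\mu,\omega,M,\alpha,\Delta>0$ and $\rho_{BS},\rho_{D2D}\ge 0$ be real numbers and $1\le h\le n$ integers. Nodes arrive in a cell according to a Poisson process of rate $N\mu$, each stays for an exponential time of rate $\mu$, and the number of nodes at time $0$ is Poisson with mean $N$ (the stationary $M/M/\infty$ queue; the nodes present at time $0$ have exponential residual times of rate $\mu$). While in the cell, each node requests a file of $M$ bits at random times with i.i.d. exponential inter-request times of rate $\omega$. The file is encoded and stored in $n$ storage nodes, $\alpha$ bits in each. A storage node stays in the cell for an exponential (residual) time of rate $\mu$, and at the times $\Delta,2\Delta,3\Delta,\dots$ all storage nodes that have left are replaced, so that there are $n$ again. All these random variables are independent; in particular, requests are independent of the departures of storage nodes. If at least $h$ storage nodes are in the cell at the time of a request, the file is downloaded from $h$ of them (D2D download), at cost $\rho_{D2D}h\alpha$; otherwise it is downloaded from the base station (BS download), at cost $\rho_{BS}M$. Let $S_h$ be the time at which the number of storage nodes, starting from $n$ at time $0$ and without repair, drops below $h$. Let $W_l$ be the sum of the first $l$ inter-request times of a node, and $\tilde W_l=W_l \bmod \Delta\in[0,\Delta)$. Put $$\Pr\{\text{D2D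 download}\}=\lim_{L\to\infty}\frac1L\sum_{l=1}^{L}\Pr(\tilde W_l<S_h),\qquad \Pr\{\text{BS download}\}=\lim_{L\to\infty}\frac1L\sum_{l=1}^{L}\Pr(\tilde W_l\ge S_h).$$ Let $E(C_d)$ be the average download cost per bit and time unit, that is, the expected total cost of all downloads requested in a repair interval $[q\Delta,(q+1)\Delta)$, $q\in\{0,1,2,\dots\}$, divided by $M\Delta$. **Theorem 2.** The two limits exist and do not depend on the node, $\Pr\{\text{BS download}\}+\Pr\{\text{D2D download}\}=1$, the average download cost $E(C_d)$ is finite and the same for every repair interval, and, with $\mu_i=i\mu$ and $p_i=e^{-\mu_i\Delta}$ for $i\in\{h,\dots,n\}$, $$E(C_d)=\frac{N\omega}{M}\Big(\rho_{BS}M\Pr\{\text{BS download}\}+\rho_{D2D}h\alpha\Pr\{\text{D2D download}\}\Big)$$ $$=N\omega\Bigg(\rho_{BS}+\Big(\rho_{D2D}\frac{h\alpha}{M}-\rho_{BS}\Big)\frac1\Delta\sum_{i=h}^{n}\frac{1-p_i}{\mu_i}\prod_{\substack{j=h\\ j\ne i}}^{n}\frac{\mu_j}{\mu_j-\mu_i}\Bigg).$$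 -/

import Mathlib

open MeasureTheory ProbabilityTheory Filter Topology
open scoped ENNReal

/-- Parameters of the wireless network with distributed storage. -/
structure DSNetwork where
  /-- average number of nodes in the cell -/
  N : ℝ
  /-- departure rate of a node; also the arrival rate per node (`λ = μ`), so that nodes arrive
  at total rate `N * μ` -/
  μ : ℝ
  /-- request rate per node -/
  ω : ℝ
  /-- file size in bits -/
  M : ℝ
  /-- cost per bit of a transmission from the base station -/
  ρBS : ℝ
  /-- cost per bit of a device-to-device transmission -/
  ρD2D : ℝ
  /-- number of bits stored in each storage node -/
  α : ℝ
  /-- repair interval -/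
  Δ : ℝ
  /-- number of storage nodes after each repair -/
  n : ℕ
  /-- number of storage nodes contacted in a D2D download -/
  h : ℕ
  N_pos : 0 < N
  μ_pos : 0 < μ
  ω_pos : 0 < ω
  M_pos : 0 < M
  ρBS_nonneg : 0 ≤ ρBS
  ρD2D_nonneg : 0 ≤ ρD2D
  α_pos : 0 < α
  Δ_pos : 0 < Δ
  one_le_h : 1 ≤ h
  h_le_n : h ≤ n

/-- Labels of the nodes that may request the file: those that are in the cell at time `0`, and
those that arrive later. -/
inductive CellNode : Type
  | initial (j : ℕ)
  | arriving (j : ℕ)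

/-- Labels of the exponential times that drive the network: the inter-arrival times of nodes,
the (residual) time each node stays in the cell, the inter-request times of each node, and the
(residual) time that the `k`-th node placed in storage position `i` stays in the cell. -/
inductive Clock (n : ℕ) : Type
  | interarrival (j : ℕ)
  | lifetime (v : CellNode)
  | request (v : CellNode) (l : ℕ)
  | storage (i : Fin n) (k : ℕ)

namespace DSNetwork

variable (S : DSNetwork)

/-- Rate of each exponential time. -/
def rate : Clock S.n → ℝ
  | .interarrival _ => S.N * S.μ
  | .lifetime _ => S.μ
  | .request _ _ => S.ω
  | .storage _ _ => S.μ

/-- `X` is a family of independent exponential times with the rates of the network, and `K`, the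
number of nodes in the cell at time `0`, is independent of it and Poisson with mean `N` (the
stationary law of the `M/M/∞` queue of nodes). -/
structure IsModel {Ω : Type*} [MeasurableSpace Ω] (P : Measure Ω)
    (X : Clock S.n → Ω → ℝ) (K : Ω → ℕ) : Prop where
  hasLaw_clock : ∀ c, HasLaw (X c) (expMeasure (S.rate c)) P
  hasLaw_initial : HasLaw K (poissonMeasure S.N.toNNReal) P
  iIndepFun_clock : iIndepFun X P
  indepFun_initial : IndepFun K (fun x c => X c x) P

section Paths

/-! In this section `x` is one outcome of all the exponential times. -/

variable (x : Clock S.n → ℝ)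

/-- Time at which the `k`-th node is placed in storage position `i`: the first at time `0`, and
each next one at the first repair instant (multiple of `Δ`) not before the departure of the
previous one. -/
noncomputable def placementTime (i : Fin S.n) : ℕ → ℝ
  | 0 => 0
  | k + 1 => S.Δ * (⌈(placementTime i k + x (.storage i k)) / S.Δ⌉ : ℤ)

/-- Number of storage nodes in the cell at time `t`. -/
noncomputable def storageCount (t : ℝ) : ℕ :=
  {i : Fin S.n | ∃ k, S.placementTime x i k ≤ t ∧
    t < S.placementTime x i k + x (.storage i k)}.ncard

/-- Cost of a download requested at time `t`: `h * α` bits from storage nodes if at least `h` of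
them are in the cell, and otherwise `M` bits from the base station. -/
noncomputable def requestCost (t : ℝ) : ℝ :=
  if S.h ≤ S.storageCount x t then S.ρD2D * (S.h * S.α) else S.ρBS * S.M

/-- Time at which a node starts to be in the cell. -/
noncomputable def arrivalTime : CellNode → ℝ
  | .initial _ => 0
  | .arriving j => ∑ i ∈ Finset.range (j + 1), x (.interarrival i)

/-- Sum `W_l` of the first `l` inter-request times of node `v`. -/
noncomputable def requestClock (v : CellNode) (l : ℕ) : ℝ :=
  ∑ i ∈ Finset.range l, x (.request v i)

/-- Whether the node `v` ever is in the cell, when `K` nodes are there at time `0`. -/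
def IsPresent (K : ℕ) : CellNode → Prop
  | .initial j => j < K
  | .arriving _ => True

open Classical in
/-- Total cost of the downloads requested by all nodes, while they are in the cell, during the
repair interval `[q * Δ, (q + 1) * Δ)`, when `K` nodes are in the cell at time `0`. -/
noncomputable def intervalCost (K : ℕ) (q : ℕ) : ℝ≥0∞ :=
  ∑' (v : CellNode) (l : ℕ),
    if IsPresent K v ∧ S.requestClock x v (l + 1) < x (.lifetime v) ∧
        S.arrivalTime x v + S.requestClock x v (l + 1) ∈ Set.Ico (q * S.Δ) ((q + 1) * S.Δ)
    then ENNReal.ofReal (S.requestCost x (S.arrivalTime x v + S.requestClock x v (l + 1)))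
    else 0

/-- The instant `S_h` at which the number of storage nodes, starting from `n` and without repair,
drops below `h`. -/
noncomputable def depletionTime : ℝ :=
  sInf {t : ℝ | 0 ≤ t ∧ {i : Fin S.n | t < x (.storage i 0)}.ncard < S.h}

/-- `W_l` modulo `Δ`, in `[0, Δ)`. -/
noncomputable def requestPhase (v : CellNode) (l : ℕ) : ℝ :=
  S.Δ * Int.fract (S.requestClock x v l / S.Δ)

end Paths

variable {Ω : Type*} [MeasurableSpace Ω] (P : Measure Ω) (X : Clock S.n → Ω → ℝ) (K : Ω → ℕ)

/-- `p` is the probability of D2D download: the long-run average, over the requests of any node,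
of the probability that the request time modulo `Δ` falls before `S_h`. -/
def HasD2DProb (p : ℝ) : Prop :=
  ∀ v : CellNode, Tendsto (fun L : ℕ => (1 / (L : ℝ)) * ∑ l ∈ Finset.Icc 1 L,
    P.real {ξ | S.requestPhase (fun c => X c ξ) v l < S.depletionTime (fun c => X c ξ)})
    atTop (𝓝 p)

/-- `p` is the probability of BS download: as before, but not before `S_h`. -/
def HasBSProb (p : ℝ) : Prop :=
  ∀ v : CellNode, Tendsto (fun L : ℕ => (1 / (L : ℝ)) * ∑ l ∈ Finset.Icc 1 L,
    P.real {ξ | S.depletionTime (fun c => X c ξ) ≤ S.requestPhase (fun c => X c ξ) v l})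
    atTop (𝓝 p)

/-- Expected total download cost in the repair interval `[q * Δ, (q + 1) * Δ)`. -/
noncomputable def expectedIntervalCost (q : ℕ) : ℝ≥0∞ :=
  ∫⁻ ξ, S.intervalCost (fun c => X c ξ) (K ξ) q ∂P

/-- `e` is the average download cost: in every repair interval the expected total download cost
is finite and, normalized by the file size and by the length of the interval, equal to `e`. -/
def HasAvgDownloadCost (e : ℝ) : Prop :=
  ∀ q : ℕ, S.expectedIntervalCost P X K q ≠ ⊤ ∧
    (S.expectedIntervalCost P X K q).toReal / (S.M * S.Δ) = e

/-- Departure rate `μ_i = i * μ` while `i` storage nodes are in the cell. -/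
def deathRate (i : ℕ) : ℝ := i * S.μ

end DSNetwork

/-! Both formulas rest on two facts: a storage law that depends only on the time since the last
repair, and the flat renewal measure of exponential sums.

Storage. At a repair instant every position is filled, and by memorylessness its occupant then has
an exponential residual time. So at time `s` after the repair each position is filled with
probability `exp (-μ s)`, independently of the others (`measureReal_filled`). The event that at
least `h` positions are filled therefore has the same binomial tail probability, `survival s`, as
the event `s < S_h` in the system without repair. Partial fractions turn this tail into a
combination of the exponentials `exp (-i μ s)` (`sum_bernsteinPolynomial_Icc`), and its mean over
`[0, Δ]`, called `d2dProb`, is the sum in the theorem.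

Requests. If `W_l` are partial sums of exponential times of rate `r`, then `∑_{l ≤ L} E f(W_l) = r E
∫_0^{W_L} f` (`sum_lintegral`). For the long-run averages take `f(t) = survival (t mod Δ)`. It is
periodic with values in `[0, 1]`, so the integral differs from `W_L * d2dProb` by at most `Δ`; since
`ω E W_L = L`, the sum of the first `L` probabilities is `L * d2dProb` up to `ω Δ`. Dividing by `L`
gives the limit, without any equidistribution theorem for the phases.

Cost. As `L → ∞` the identity says that the renewal measure is `r dt` on `(0, ∞)`
(`tsum_lintegral`). Let `f` be the mean cost of a request at a given time, set to zero outside one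
repair interval. Integrating out storage, lifetimes, requests and arrivals in turn leaves `N ω`
times an integral of `f`. A node present initially is still there at time `s` with probability `exp
(-μ s)`, and later arrivals supply the missing `1 - exp (-μ s)` (`lintegral_stationary`). The total
is `N ω ∫ f`, the same for every interval. -/

section ExponentialWalk

/-! ### Exponential laws and the renewal measure of their partial sums. -/

theorem lintegral_expMeasure (r : ℝ) {f : ℝ → ℝ≥0∞} (hf : Measurable f) :
    ∫⁻ x, f x ∂expMeasure r = ∫⁻ x in Set.Ioi 0, ENNReal.ofReal (r * Real.exp (-(r * x))) * f x := by
  have h1 : expMeasure r = volume.withDensity (exponentialPDF r) := rfl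
  have hm : Measurable (exponentialPDF r) := (measurable_exponentialPDFReal r).ennreal_ofReal
  rw [h1, lintegral_withDensity_eq_lintegral_mul _ hm hf, ← lintegral_indicator measurableSet_Ioi]
  refine lintegral_congr_ae ?_
  filter_upwards [Measure.ae_ne volume (0 : ℝ)] with x hx
  by_cases h : 0 < x
  · simp [h, exponentialPDF_of_nonneg h.le]
  · have : x < 0 := lt_of_le_of_ne (not_lt.1 h) hx
    simp [h, exponentialPDF_of_neg this]

theorem expMeasure_Ioi {r : ℝ} (hr : 0 < r) {t : ℝ} (ht : 0 ≤ t) :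
    expMeasure r (Set.Ioi t) = ENNReal.ofReal (Real.exp (-(r * t))) := by
  have := isProbabilityMeasure_expMeasure hr
  have h := cdf_expMeasure_eq hr t
  rw [if_pos ht, cdf_eq_real] at h
  have h2 := probReal_compl_eq_one_sub (μ := expMeasure r) (measurableSet_Iic (a := t))
  rw [Set.compl_Iic, h] at h2
  rw [← ofReal_measureReal, h2]
  congr 1
  ring

theorem ae_expMeasure_pos {r : ℝ} (hr : 0 < r) : ∀ᵐ x ∂expMeasure r, 0 < x := by
  have := isProbabilityMeasure_expMeasure hr
  have h := expMeasure_Ioi hr le_rfl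
  rw [mul_zero, neg_zero, Real.exp_zero, ENNReal.ofReal_one] at h
  exact (prob_compl_eq_zero_iff measurableSet_Ioi).2 h

theorem measurable_setLIntegral_Ioc {f : ℝ → ℝ≥0∞} (hf : Measurable f) :
    Measurable fun p : ℝ × ℝ => ∫⁻ t in Set.Ioc p.1 p.2, f t := by
  simp_rw [← lintegral_indicator measurableSet_Ioc]
  refine Measurable.lintegral_prod_right' (f := fun q : (ℝ × ℝ) × ℝ =>
    (Set.Ioc q.1.1 q.1.2).indicator f q.2) ?_
  have : (fun q : (ℝ × ℝ) × ℝ => (Set.Ioc q.1.1 q.1.2).indicator f q.2) =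
      {q : (ℝ × ℝ) × ℝ | q.1.1 < q.2 ∧ q.2 ≤ q.1.2}.indicator (fun q => f q.2) := by
    ext q; simp [Set.indicator, Set.mem_Ioc]
  rw [this]
  refine (hf.comp measurable_snd).indicator ?_
  exact (measurableSet_lt measurable_fst.fst measurable_snd).inter
    (measurableSet_le measurable_snd measurable_fst.snd)

/-- Tonelli for the area under a random point. -/
theorem lintegral_setLIntegral_Ioc {β : Type*} [MeasurableSpace β] (ν : Measure β) [SFinite ν]
    {T : β → ℝ} (hT : Measurable T) {f : ℝ → ℝ≥0∞} (hf : Measurable f) :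
    ∫⁻ x, (∫⁻ t in Set.Ioc 0 (T x), f t) ∂ν = ∫⁻ t in Set.Ioi 0, f t * ν {x | t ≤ T x} := by
  have h1 : ∀ x, ∫⁻ t in Set.Ioc 0 (T x), f t =
      ∫⁻ t in Set.Ioi 0, {x | t ≤ T x}.indicator (fun _ => f t) x := by
    intro x
    rw [← lintegral_indicator measurableSet_Ioc, ← lintegral_indicator measurableSet_Ioi]
    refine lintegral_congr fun t => ?_
    by_cases h1 : 0 < t <;> by_cases h2 : t ≤ T x <;> simp [h1, h2]
  simp_rw [h1]
  rw [lintegral_lintegral_swap]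
  · refine lintegral_congr fun t => ?_
    rw [lintegral_indicator (measurableSet_le measurable_const hT), setLIntegral_const]
  · refine Measurable.aemeasurable ?_
    have : (Function.uncurry fun x t => {x | t ≤ T x}.indicator (fun _ => f t) x) =
        {q : β × ℝ | q.2 ≤ T q.1}.indicator (fun q => f q.2) := by
      ext q; simp [Set.indicator, Function.uncurry]
    rw [this]
    exact (hf.comp measurable_snd).indicator (measurableSet_le measurable_snd (hT.comp measurable_fst))

theorem expMeasure_Ici {r : ℝ} (hr : 0 < r) {t : ℝ} (ht : 0 ≤ t) :
    expMeasure r (Set.Ici t) = ENNReal.ofReal (Real.exp (-(r * t))) := by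
  rw [← expMeasure_Ioi hr ht]
  refine measure_congr (Ioi_ae_eq_Ici' ?_).symm
  have h1 : expMeasure r = volume.withDensity (exponentialPDF r) := rfl
  rw [h1]
  exact withDensity_absolutelyContinuous _ _ Real.volume_singleton

/-- The exponential density at `t` is `r` times the tail probability of `[t, ∞)`; Tonelli turns the
tail into the expected integral over the gap. This is one step of the walk from the point `a`. -/
theorem lintegral_expMeasure_eq_lintegral_Ioc {r : ℝ} (hr : 0 < r) {f : ℝ → ℝ≥0∞}
    (hf : Measurable f) (a : ℝ) :
    ∫⁻ x, f (a + x) ∂expMeasure r =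
      ENNReal.ofReal r * ∫⁻ x, (∫⁻ t in Set.Ioc a (a + x), f t) ∂expMeasure r := by
  have := isProbabilityMeasure_expMeasure hr
  have h1 : ∀ x, ∫⁻ t in Set.Ioc a (a + x), f t = ∫⁻ t in Set.Ioc 0 x, f (a + t) := by
    intro x
    rw [← lintegral_indicator measurableSet_Ioc, ← lintegral_indicator measurableSet_Ioc,
      ← lintegral_add_left_eq_self _ a]
    refine lintegral_congr fun t => ?_
    simp [Set.indicator]
  have hf' : Measurable fun t => f (a + t) := hf.comp (measurable_const_add a)
  simp_rw [h1]
  rw [lintegral_setLIntegral_Ioc (expMeasure r) (T := fun x => x) measurable_id hf',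
    lintegral_expMeasure r hf', ← lintegral_const_mul' _ _ ENNReal.ofReal_ne_top]
  refine setLIntegral_congr_fun measurableSet_Ioi fun t ht => ?_
  have : expMeasure r {x | t ≤ x} = _ := expMeasure_Ici hr (le_of_lt ht)
  simp only [this]
  rw [ENNReal.ofReal_mul hr.le]
  ring

/-- Integrating out an independent variable. -/
theorem lintegral_of_indepFun {Ω β γ : Type*} [MeasurableSpace Ω] [MeasurableSpace β]
    [MeasurableSpace γ] {P : Measure Ω} [IsProbabilityMeasure P] {U : Ω → β} {V : Ω → γ}
    (hU : Measurable U) (hV : Measurable V) (h : IndepFun U V P) {F : β → γ → ℝ≥0∞}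
    (hF : Measurable (Function.uncurry F)) :
    ∫⁻ ξ, F (U ξ) (V ξ) ∂P = ∫⁻ ξ, ∫⁻ ξ', F (U ξ) (V ξ') ∂P ∂P := by
  have h1 := (indepFun_iff_map_prod_eq_prod_map_map hU.aemeasurable hV.aemeasurable).1 h
  have h2 : ∫⁻ ξ, F (U ξ) (V ξ) ∂P = ∫⁻ p, Function.uncurry F p ∂(P.map fun ξ => (U ξ, V ξ)) := by
    rw [lintegral_map hF (hU.prodMk hV)]; rfl
  have := Measure.isProbabilityMeasure_map (μ := P) hV.aemeasurable
  rw [h2, h1, lintegral_prod _ hF.aemeasurable, lintegral_map _ hU]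
  · refine lintegral_congr fun ξ => ?_
    rw [lintegral_map _ hV]
    · rfl
    · exact hF.comp measurable_prodMk_left
  · exact hF.lintegral_prod_right'

variable {Ω : Type*} [MeasurableSpace Ω] {P : Measure Ω} [IsProbabilityMeasure P] {r : ℝ}
  {Y : ℕ → Ω → ℝ}

/-- `Y` is a sequence of positive i.i.d. exponential times of rate `r`. -/
structure IsExpWalk (P : Measure Ω) (r : ℝ) (Y : ℕ → Ω → ℝ) : Prop where
  rate_pos : 0 < r
  measurable : ∀ l, Measurable (Y l)
  map_eq : ∀ l, P.map (Y l) = expMeasure r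
  -- Independence of each step from the sum before it is all that the induction in `sum_lintegral`
  -- uses.
  indep : ∀ L, IndepFun (fun ξ => ∑ i ∈ Finset.range L, Y i ξ) (Y L) P

namespace IsExpWalk

omit [IsProbabilityMeasure P] in

theorem ae_pos (h : IsExpWalk P r Y) : ∀ᵐ ξ ∂P, ∀ l, 0 < Y l ξ := by
  refine ae_all_iff.2 fun l => ?_
  have := ae_expMeasure_pos h.rate_pos
  rw [← h.map_eq l] at this
  exact ae_of_ae_map (h.measurable l).aemeasurable this

omit [IsProbabilityMeasure P] in
theorem measurable_sum (h : IsExpWalk P r Y) (L : ℕ) :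
    Measurable fun ξ => ∑ i ∈ Finset.range L, Y i ξ :=
  Finset.measurable_fun_sum _ fun i _ => h.measurable i

/-- Each new point contributes `r` times the expected integral over the gap before it, and
consecutive gaps tile `(0, W_L]`. -/
theorem sum_lintegral (h : IsExpWalk P r Y) {f : ℝ → ℝ≥0∞} (hf : Measurable f) (L : ℕ) :
    ∑ l ∈ Finset.range L, ∫⁻ ξ, f (∑ i ∈ Finset.range (l + 1), Y i ξ) ∂P =
      ENNReal.ofReal r * ∫⁻ ξ, (∫⁻ t in Set.Ioc 0 (∑ i ∈ Finset.range L, Y i ξ), f t) ∂P := by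
  induction L with
  | zero => simp
  | succ L ih =>
    have hI := measurable_setLIntegral_Ioc hf
    have e1 : ∫⁻ ξ, f (∑ i ∈ Finset.range (L + 1), Y i ξ) ∂P = ENNReal.ofReal r *
        ∫⁻ ξ, (∫⁻ t in Set.Ioc (∑ i ∈ Finset.range L, Y i ξ)
          (∑ i ∈ Finset.range (L + 1), Y i ξ), f t) ∂P := by
      simp_rw [Finset.sum_range_succ]
      rw [lintegral_of_indepFun (F := fun a b => f (a + b)) (h.measurable_sum L) (h.measurable L)
          (h.indep L) (hf.comp (by fun_prop)),
        lintegral_of_indepFun (F := fun a b => ∫⁻ t in Set.Ioc a (a + b), f t)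
          (h.measurable_sum L) (h.measurable L) (h.indep L)
          (hI.comp (measurable_fst.prodMk (measurable_fst.add measurable_snd))),
        ← lintegral_const_mul' _ _ ENNReal.ofReal_ne_top]
      refine lintegral_congr fun ξ => ?_
      have := lintegral_expMeasure_eq_lintegral_Ioc h.rate_pos hf (∑ i ∈ Finset.range L, Y i ξ)
      rw [← h.map_eq L] at this
      refine ((lintegral_map (hf.comp (measurable_const_add _)) (h.measurable L)).symm.trans
        this).trans ?_
      congr 1
      exact lintegral_map (hI.comp (measurable_const.prodMk (measurable_const_add _)))
        (h.measurable L)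
    rw [Finset.sum_range_succ, ih, e1, ← mul_add, ← lintegral_add_left]
    · congr 1
      refine lintegral_congr_ae ?_
      filter_upwards [h.ae_pos] with ξ hξ
      have h0 : 0 ≤ ∑ i ∈ Finset.range L, Y i ξ := Finset.sum_nonneg fun i _ => (hξ i).le
      have h1 : ∑ i ∈ Finset.range L, Y i ξ ≤ ∑ i ∈ Finset.range (L + 1), Y i ξ := by
        rw [Finset.sum_range_succ]; linarith [hξ L]
      rw [← lintegral_union measurableSet_Ioc (Set.Ioc_disjoint_Ioc_of_le le_rfl),
        Set.Ioc_union_Ioc_eq_Ioc h0 h1]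
    · exact hI.comp (measurable_const.prodMk (h.measurable_sum L))

theorem lintegral_sum (h : IsExpWalk P r Y) (L : ℕ) :
    ENNReal.ofReal r * ∫⁻ ξ, ENNReal.ofReal (∑ i ∈ Finset.range L, Y i ξ) ∂P = L := by
  have := h.sum_lintegral (f := fun _ => 1) measurable_const L
  simpa using this.symm

/-- By `sum_lintegral` for the indicator of `(-∞, t)`, the expected number of partial sums below `t`
is at most `r` times the positive part of `t`. The probabilities are thus summable and tend to zero.
-/
theorem tendsto_measure_lt (h : IsExpWalk P r Y) (t : ℝ) :
    Tendsto (fun L => P {ξ | ∑ i ∈ Finset.range L, Y i ξ < t}) atTop (𝓝 0) := by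
  rw [← tendsto_add_atTop_iff_nat 1]
  refine ENNReal.tendsto_atTop_zero_of_tsum_ne_top ?_
  have hb : ∀ L, ∑ l ∈ Finset.range L, P {ξ | ∑ i ∈ Finset.range (l + 1), Y i ξ < t} ≤
      ENNReal.ofReal r * ENNReal.ofReal t := by
    intro L
    have h1 := h.sum_lintegral (f := (Set.Iio t).indicator 1)
      (measurable_one.indicator measurableSet_Iio) L
    have h2 : ∀ l, ∫⁻ ξ, (Set.Iio t).indicator (1 : ℝ → ℝ≥0∞)
        (∑ i ∈ Finset.range (l + 1), Y i ξ) ∂P =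
        P {ξ | ∑ i ∈ Finset.range (l + 1), Y i ξ < t} := by
      intro l
      rw [← lintegral_indicator_one (measurableSet_lt (h.measurable_sum _) measurable_const)]
      rfl
    simp_rw [h2] at h1
    rw [h1]
    gcongr
    calc _ ≤ ∫⁻ ξ, ENNReal.ofReal t ∂P := by
          refine lintegral_mono fun ξ => ?_
          rw [← lintegral_indicator measurableSet_Ioc]
          calc _ ≤ ∫⁻ s, (Set.Ioc 0 t).indicator 1 s := by
                refine lintegral_mono fun s => ?_
                by_cases h1 : s < t
                · simp only [Set.indicator, Set.mem_Ioc, Set.mem_Iio, h1, h1.le, and_true, if_true]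
                  split_ifs <;> simp_all
                · simp [Set.indicator, h1]
            _ = _ := by simp [lintegral_indicator_one measurableSet_Ioc]
      _ = _ := by simp
  refine ne_top_of_le_ne_top (b := ENNReal.ofReal r * ENNReal.ofReal t)
    (ENNReal.mul_ne_top ENNReal.ofReal_ne_top ENNReal.ofReal_ne_top) ?_
  rw [ENNReal.tsum_eq_iSup_nat]
  exact iSup_le hb

/-- The renewal measure of exponential times is Lebesgue measure times the rate. -/
theorem tsum_lintegral (h : IsExpWalk P r Y) {f : ℝ → ℝ≥0∞} (hf : Measurable f) :
    ∑' l, ∫⁻ ξ, f (∑ i ∈ Finset.range (l + 1), Y i ξ) ∂P =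
      ENNReal.ofReal r * ∫⁻ t in Set.Ioi 0, f t := by
  refine tendsto_nhds_unique (ENNReal.tendsto_nat_tsum _) ?_
  simp_rw [h.sum_lintegral hf, lintegral_setLIntegral_Ioc P (h.measurable_sum _) hf]
  refine ENNReal.Tendsto.const_mul ?_ (Or.inr ENNReal.ofReal_ne_top)
  -- Monotone convergence: the probability that the `L`-th partial sum is at least `t` increases to
  -- `1`.
  refine lintegral_tendsto_of_tendsto_of_monotone (fun L => ?_) (ae_of_all _ fun t => ?_)
    (ae_of_all _ fun t => ?_)
  · refine (hf.mul ?_).aemeasurable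
    have : Antitone fun t => P {ξ | t ≤ ∑ i ∈ Finset.range L, Y i ξ} :=
      fun a b hab => measure_mono fun ξ hξ => le_trans hab hξ
    exact this.measurable
  · refine monotone_nat_of_le_succ fun L => ?_
    refine mul_le_mul' le_rfl ?_
    have hle : {ξ | t ≤ ∑ i ∈ Finset.range L, Y i ξ} ≤ᵐ[P]
        {ξ | t ≤ ∑ i ∈ Finset.range (L + 1), Y i ξ} := by
      filter_upwards [h.ae_pos] with ξ hξ hξ'
      change t ≤ _ at hξ'
      change t ≤ _
      rw [Finset.sum_range_succ]; linarith [hξ L]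
    exact measure_mono_ae hle
  · have h1 : Tendsto (fun L => P {ξ | t ≤ ∑ i ∈ Finset.range L, Y i ξ}) atTop (𝓝 1) := by
      have h2 : ∀ L, P {ξ | t ≤ ∑ i ∈ Finset.range L, Y i ξ} =
          1 - P {ξ | ∑ i ∈ Finset.range L, Y i ξ < t} := by
        intro L
        rw [← prob_compl_eq_one_sub (measurableSet_lt (h.measurable_sum L) measurable_const)]
        congr 1
        ext ξ; simp
      simp_rw [h2]
      simpa using ENNReal.Tendsto.sub (tendsto_const_nhds (x := (1 : ℝ≥0∞)))
        (h.tendsto_measure_lt t) (Or.inl ENNReal.one_ne_top)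
    simpa using ENNReal.Tendsto.const_mul (a := f t) h1 (Or.inl one_ne_zero)

end IsExpWalk

end ExponentialWalk

/-! ### Independence of disjoint groups of variables. -/

section IndependentGroups

variable {Ω ι : Type*} [MeasurableSpace Ω] {P : Measure Ω} {X : ι → Ω → ℝ}

/-- Setting the coordinates outside `S` to zero plays the role of restriction to `S`. Every group of
variables then lives in the same space `ι → ℝ`, where path functionals apply unchanged. -/
theorem measurable_set_indicator (S : Set ι) :
    Measurable fun x : ι → ℝ => S.indicator x := by
  classical
  refine measurable_pi_lambda _ fun c => ?_
  by_cases h : c ∈ S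
  · simpa [h] using measurable_pi_apply c
  · simp [h]

/-- The members of an independent family with indices in two disjoint sets are independent. -/
theorem indepFun_indicator_of_disjoint (hX : ∀ c, Measurable (X c)) (h : iIndepFun X P)
    {S T : Set ι} (hST : Disjoint S T) :
    IndepFun (fun ξ => S.indicator fun c => X c ξ) (fun ξ => T.indicator fun c => X c ξ) P := by
  have key : ∀ S : Set ι, MeasurableSpace.comap (fun ξ => S.indicator fun c => X c ξ)
      MeasurableSpace.pi ≤ ⨆ c ∈ S, MeasurableSpace.comap (X c) inferInstance := by
    intro S
    refine Measurable.comap_le ?_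
    refine @measurable_pi_lambda _ _ _ (_) _ _ fun c => ?_
    by_cases hc : c ∈ S
    · have h1 : MeasurableSpace.comap (X c) inferInstance ≤
          ⨆ c ∈ S, MeasurableSpace.comap (X c) inferInstance :=
        le_biSup (fun c => MeasurableSpace.comap (X c) inferInstance) hc
      simpa [hc] using (comap_measurable (X c)).mono h1 le_rfl
    · simp [hc]
  refine (IndepFun_iff_Indep _ _ _).2 ?_
  exact indep_of_indep_of_le_left (indep_of_indep_of_le_right
    (indep_iSup_of_disjoint (fun c => (hX c).comap_le) h.iIndep hST) (key T)) (key S)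

/-- Independent functions of two disjoint sets of members of an independent family. -/
theorem indepFun_of_disjoint {β γ : Type*} [MeasurableSpace β] [MeasurableSpace γ]
    (hX : ∀ c, Measurable (X c)) (h : iIndepFun X P) {S T : Set ι} (hST : Disjoint S T)
    {F : (ι → ℝ) → β} {G : (ι → ℝ) → γ} (hF : Measurable F) (hG : Measurable G)
    (hFS : ∀ x, F (S.indicator x) = F x) (hGT : ∀ x, G (T.indicator x) = G x) :
    IndepFun (fun ξ => F fun c => X c ξ) (fun ξ => G fun c => X c ξ) P := by
  have := (indepFun_indicator_of_disjoint hX h hST).comp hF hG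
  simpa [Function.comp_def, hFS, hGT] using this

/-- Induction on the finite set of blocks: one block is independent of the union of the others, and
an event about those is an event about the variables of their union. -/
theorem iIndepFun_indicator_of_pairwise_disjoint [IsProbabilityMeasure P]
    (hX : ∀ c, Measurable (X c)) (h : iIndepFun X P) {κ : Type*} {R : κ → Set ι}
    (hR : Pairwise (Function.onFun Disjoint R)) :
    iIndepFun (fun i ξ => (R i).indicator fun c => X c ξ) P := by
  classical
  rw [iIndepFun_iff_measure_inter_preimage_eq_mul]
  intro s
  induction s using Finset.induction_on with
  | empty => intro A _; simp
  | insert a s ha ih =>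
    intro A hA
    have hd : Disjoint (R a) (⋃ i ∈ s, R i) := by
      rw [Set.disjoint_iUnion₂_right]
      exact fun i hi => hR (fun e => ha (e ▸ hi))
    have h1 := indepFun_indicator_of_disjoint hX h hd
    let B : Set (ι → ℝ) := ⋂ i ∈ s, {x | (R i).indicator x ∈ A i}
    have hB : MeasurableSet B := by
      refine Finset.measurableSet_biInter _ fun i hi => ?_
      exact measurable_set_indicator (R i) (hA i (Finset.mem_insert_of_mem hi))
    have hpre : (fun ξ => (⋃ i ∈ s, R i).indicator fun c => X c ξ) ⁻¹' B =
        ⋂ i ∈ s, (fun ξ => (R i).indicator fun c => X c ξ) ⁻¹' A i := by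
      ext ξ
      simp only [B, Set.mem_preimage, Set.mem_iInter, Set.mem_ofPred_eq]
      refine forall₂_congr fun i hi => ?_
      have hsub : R i ⊆ ⋃ i ∈ s, R i := Set.subset_iUnion₂_of_subset i hi subset_rfl
      rw [Set.indicator_indicator, Set.inter_eq_left.2 hsub]
    rw [Finset.set_biInter_insert, Finset.prod_insert ha,
      ← ih fun i hi => hA i (Finset.mem_insert_of_mem hi), ← hpre]
    exact h1.measure_inter_preimage_eq_mul _ _ (hA a (Finset.mem_insert_self _ _)) hB

end IndependentGroups

/-! ### The binomial law of a number of independent events. -/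

section Counting

theorem measurable_ncard_setOf {α : Type*} [MeasurableSpace α] {n : ℕ} {p : Fin n → α → Prop}
    (hp : ∀ i, MeasurableSet {a | p i a}) : Measurable fun a => {i | p i a}.ncard := by
  classical
  have : (fun a => {i | p i a}.ncard) = fun a => ∑ i, if p i a then 1 else 0 := by
    ext a
    rw [Set.ncard_eq_toFinset_card', Finset.sum_boole]
    simp
  rw [this]
  exact Finset.measurable_fun_sum _ fun i _ =>
    Measurable.ite (hp i) measurable_const measurable_const

/-- The number of occurring events, among `n` independent ones of probability `p`, is binomial. -/
theorem measureReal_le_ncard {Ω β : Type*} [MeasurableSpace Ω] [MeasurableSpace β] {P : Measure Ω}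
    [IsProbabilityMeasure P] {n : ℕ} {g : Fin n → Ω → β} (hg : ∀ i, Measurable (g i))
    (hi : iIndepFun g P) {A : Fin n → Set β} (hA : ∀ i, MeasurableSet (A i)) {p : ℝ}
    (hp : ∀ i, P.real (g i ⁻¹' A i) = p) (h : ℕ) :
    P.real {ξ | h ≤ {i | g i ξ ∈ A i}.ncard} =
      ∑ m ∈ Finset.Icc h n, (n.choose m : ℝ) * p ^ m * (1 - p) ^ (n - m) := by
  classical
  -- The events `C J i`, for all `i` together, say that exactly the indices in `J` occur.
  let C : Finset (Fin n) → Fin n → Set β := fun J i => if i ∈ J then A i else (A i)ᶜ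
  have hC : ∀ J i, MeasurableSet (C J i) := by
    intro J i
    by_cases h : i ∈ J
    · simpa [C, h] using hA i
    · simpa [C, h] using hA i
  have hmem : ∀ J ξ, (ξ ∈ ⋂ i, g i ⁻¹' C J i) ↔ {i | g i ξ ∈ A i} = (J : Set (Fin n)) := by
    intro J ξ
    simp only [Set.mem_iInter, Set.mem_preimage, Set.ext_iff, Set.mem_ofPred_eq, Finset.mem_coe]
    refine forall_congr' fun i => ?_
    by_cases h : i ∈ J <;> simp [C, h]
  have hset : {ξ | h ≤ {i | g i ξ ∈ A i}.ncard} =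
      ⋃ J ∈ (Finset.univ : Finset (Fin n)).powerset.filter (fun J => h ≤ J.card),
        ⋂ i, g i ⁻¹' C J i := by
    ext ξ
    simp only [Set.mem_iUnion, hmem, Finset.mem_filter, Finset.mem_powerset, Finset.subset_univ,
      true_and, Set.mem_ofPred_eq]
    constructor
    · intro hξ
      refine ⟨{i | g i ξ ∈ A i}.toFinset, ?_, by simp⟩
      rwa [← Set.ncard_eq_toFinset_card']
    · rintro ⟨J, hJ, e⟩
      rwa [e, Set.ncard_coe_finset]
  have hP : ∀ J, P.real (⋂ i, g i ⁻¹' C J i) = p ^ J.card * (1 - p) ^ (n - J.card) := by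
    intro J
    have h1 := hi.measure_inter_preimage_eq_mul Finset.univ (sets := C J) fun i _ => hC J i
    have h2 : P.real (⋂ i, g i ⁻¹' C J i) = ∏ i, P.real (g i ⁻¹' C J i) := by
      simp only [Finset.mem_univ, Set.iInter_true] at h1
      rw [measureReal_def, h1, ENNReal.toReal_prod]
      rfl
    have h3 : ∀ i, P.real (g i ⁻¹' C J i) = if i ∈ J then p else 1 - p := by
      intro i
      by_cases h : i ∈ J
      · simp [C, h, hp]
      · simp only [C, h, if_false]
        rw [Set.preimage_compl, probReal_compl_eq_one_sub (hg i (hA i)), hp]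
    rw [h2]
    simp_rw [h3]
    rw [Finset.prod_ite, Finset.prod_const, Finset.prod_const]
    congr 2
    · congr 1; ext; simp
    · have : Finset.univ.filter (fun i => i ∉ J) = Jᶜ := by ext; simp
      rw [this, Finset.card_compl, Fintype.card_fin]
  rw [hset, measureReal_biUnion_finset]
  · simp_rw [hP]
    rw [Finset.sum_filter, Finset.sum_powerset_apply_card
      (f := fun m => if h ≤ m then p ^ m * (1 - p) ^ (n - m) else 0)]
    rw [Finset.card_univ, Fintype.card_fin]
    have : Finset.Icc h n = (Finset.range (n + 1)).filter (fun m => h ≤ m) := by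
      ext m; simp; omega
    rw [this, Finset.sum_filter]
    refine Finset.sum_congr rfl fun m _ => ?_
    split_ifs <;> simp [mul_assoc]
  · intro J _ J' _ hne
    refine Set.disjoint_left.2 fun ξ h1 h2 => hne ?_
    rw [hmem] at h1 h2
    exact_mod_cast h1.symm.trans h2
  · exact fun J _ => MeasurableSet.iInter fun i => hg i (hC J i)

end Counting

/-! ### Partial fraction form of the binomial tail. -/

section BinomialTail

open Polynomial

theorem prod_erase_sub_eq {d k : ℕ} (hk : k ≤ d) :
    ∏ l ∈ (Finset.range (d + 1)).erase k, ((l : ℝ) - k) =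
      (-1) ^ k * k.factorial * (d - k).factorial := by
  have h1 : (Finset.range (d + 1)).erase k = Finset.range k ∪ Finset.Ico (k + 1) (d + 1) := by
    ext l; simp; omega
  rw [h1, Finset.prod_union]
  · congr 1
    · have : ∀ m : ℕ, ∏ l ∈ Finset.range m, ((l : ℝ) - m) = (-1) ^ m * m.factorial := by
        intro m
        rw [← Finset.prod_range_reflect, ← Finset.prod_range_add_one_eq_factorial]
        push_cast
        have hc : (-1 : ℝ) ^ m = ∏ l ∈ Finset.range m, (-1 : ℝ) := by simp
        rw [hc, ← Finset.prod_mul_distrib]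
        refine Finset.prod_congr rfl fun l hl => ?_
        have : l < m := by simpa using hl
        rw [Nat.sub_sub, Nat.cast_sub (by omega)]
        push_cast; ring
      exact this k
    · rw [Finset.prod_Ico_eq_prod_range, ← Finset.prod_range_add_one_eq_factorial]
      push_cast
      refine Finset.prod_congr (by congr 1) fun l _ => ?_
      ring
  · refine Finset.disjoint_left.2 fun l h1 h2 => ?_
    simp at h1 h2; omega

/-- This evaluates the coefficients `i * ∏ j / (j - i)` that arise on differentiating the power form
of the tail, with `h = H + 1`, `n = H + 1 + d`, `i = H + 1 + k`. The factor `i` fills the gap in the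
numerators, making them a rising factorial; the denominators give `(-1)^k k! (d - k)!`. -/
theorem mul_prod_erase_div (H d : ℕ) {k : ℕ} (hk : k ≤ d) :
    ((H + 1 + k : ℕ) : ℝ) * ∏ j ∈ (Finset.Icc (H + 1) (H + 1 + d)).erase (H + 1 + k),
      ((j : ℝ) / ((j : ℝ) - (H + 1 + k : ℕ))) =
      (H + d + 1 : ℕ) * (H + d).choose H * d.choose k * (-1) ^ k := by
  have h1 : (Finset.Icc (H + 1) (H + 1 + d)).erase (H + 1 + k) =
      ((Finset.range (d + 1)).erase k).map (addLeftEmbedding (H + 1)) := by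
    ext j
    simp only [Finset.mem_erase, Finset.mem_Icc, Finset.mem_map, Finset.mem_range,
      addLeftEmbedding_apply]
    constructor
    · rintro ⟨h1, h2, h3⟩
      exact ⟨j - (H + 1), ⟨by omega, by omega⟩, by omega⟩
    · rintro ⟨l, ⟨h1, h2⟩, rfl⟩
      omega
  rw [h1, Finset.prod_map, Finset.prod_div_distrib]
  simp only [addLeftEmbedding_apply]
  have h2 : ∏ l ∈ (Finset.range (d + 1)).erase k, (((H + 1 + l : ℕ) : ℝ) - (H + 1 + k : ℕ)) =
      (-1) ^ k * k.factorial * (d - k).factorial := by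
    rw [← prod_erase_sub_eq hk]
    refine Finset.prod_congr rfl fun l _ => ?_
    push_cast; ring
  have h3 : ((H + 1 + k : ℕ) : ℝ) * ∏ l ∈ (Finset.range (d + 1)).erase k, ((H + 1 + l : ℕ) : ℝ) =
      (H + 1).ascFactorial (d + 1) := by
    rw [Finset.mul_prod_erase _ (fun l => ((H + 1 + l : ℕ) : ℝ)) (by simp; omega),
      Nat.ascFactorial_eq_prod_range]
    push_cast; rfl
  rw [h2, ← mul_div_assoc, h3]
  have h4 : (H.factorial : ℝ) * (H + 1).ascFactorial (d + 1) = (H + d + 1).factorial := by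
    exact_mod_cast Nat.factorial_mul_ascFactorial H (d + 1)
  have h5 : ((H + d).choose H : ℝ) * H.factorial * d.factorial = (H + d).factorial := by
    rw [Nat.choose_symm_add]
    exact_mod_cast Nat.add_choose_mul_factorial_mul_factorial H d
  have h6 : (d.choose k : ℝ) * k.factorial * (d - k).factorial = d.factorial := by
    exact_mod_cast Nat.choose_mul_factorial_mul_factorial hk
  have h7 : ((H + d + 1).factorial : ℝ) = (H + d + 1 : ℕ) * (H + d).factorial := by
    exact_mod_cast Nat.factorial_succ (H + d)
  have hH : (H.factorial : ℝ) ≠ 0 := by positivity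
  have hs : ((-1 : ℝ) ^ k) * (-1) ^ k = 1 := by rw [← mul_pow]; simp
  rw [div_eq_iff (by simp [Nat.factorial_ne_zero])]
  apply mul_left_cancel₀ hH
  rw [h4, h7, ← h5, ← h6]
  linear_combination (-(((H + d + 1 : ℕ) : ℝ) * ((H + d).choose H) * H.factorial *
    (d.choose k * k.factorial * (d - k).factorial))) * hs

/-- The binomial tail as a combination of powers. -/
theorem sum_bernsteinPolynomial_Icc {h n : ℕ} (h1 : 1 ≤ h) (hn : h ≤ n) :
    ∑ m ∈ Finset.Icc h n, bernsteinPolynomial ℝ n m =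
      ∑ i ∈ Finset.Icc h n,
        C (∏ j ∈ (Finset.Icc h n).erase i, ((j : ℝ) / ((j : ℝ) - i))) * X ^ i := by
  obtain ⟨H, rfl⟩ : ∃ H, h = H + 1 := ⟨h - 1, by omega⟩
  obtain ⟨d, rfl⟩ : ∃ d, n = H + 1 + d := ⟨n - (H + 1), by omega⟩
  have hIcc : Finset.Icc (H + 1) (H + 1 + d) =
      (Finset.range (d + 1)).map (addLeftEmbedding (H + 1)) := by
    ext j
    simp only [Finset.mem_Icc, Finset.mem_map, Finset.mem_range, addLeftEmbedding_apply]
    constructor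
    · rintro ⟨h2, h3⟩
      exact ⟨j - (H + 1), by omega, by omega⟩
    · rintro ⟨l, h2, rfl⟩
      omega
  -- Both sides vanish at `0`, so it suffices to compare derivatives. On the left the derivatives of
  -- the Bernstein polynomials telescope to `n` times the one of degree `n - 1` and index `h - 1`.
  have hder : derivative (∑ m ∈ Finset.Icc (H + 1) (H + 1 + d),
      bernsteinPolynomial ℝ (H + 1 + d) m) =
      derivative (∑ i ∈ Finset.Icc (H + 1) (H + 1 + d), C (∏ j ∈ (Finset.Icc (H + 1)
        (H + 1 + d)).erase i, ((j : ℝ) / ((j : ℝ) - i))) * X ^ i) := by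
    have hL : derivative (∑ m ∈ Finset.Icc (H + 1) (H + 1 + d),
        bernsteinPolynomial ℝ (H + 1 + d) m) =
        ((H + d + 1 : ℕ) : ℝ[X]) * bernsteinPolynomial ℝ (H + d) H := by
      rw [derivative_sum, hIcc, Finset.sum_map]
      have : ∀ l, derivative (bernsteinPolynomial ℝ (H + 1 + d) (H + 1 + l)) =
          ((H + d + 1 : ℕ) : ℝ[X]) * (bernsteinPolynomial ℝ (H + d) (H + l) -
            bernsteinPolynomial ℝ (H + d) (H + (l + 1))) := by
        intro l
        have e1 : H + 1 + l = (H + l) + 1 := by omega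
        have e2 : H + 1 + d - 1 = H + d := by omega
        have e3 : H + 1 + d = H + d + 1 := by omega
        rw [e1, bernsteinPolynomial.derivative_succ, e2, e3]
        rfl
      simp only [addLeftEmbedding_apply, this]
      rw [← Finset.mul_sum, Finset.sum_range_sub' (fun l => bernsteinPolynomial ℝ (H + d) (H + l)),
        bernsteinPolynomial.eq_zero_of_lt ℝ (by omega : H + d < H + (d + 1)), sub_zero, add_zero]
    -- The powers of `X` come from expanding `(1 - X)^d`.
    have hbin : bernsteinPolynomial ℝ (H + d) H = ∑ k ∈ Finset.range (d + 1),
        C (((H + d).choose H : ℝ) * d.choose k * (-1) ^ k) * X ^ (H + k) := by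
      rw [bernsteinPolynomial, Nat.add_sub_cancel_left, sub_eq_neg_add, add_pow, Finset.mul_sum]
      refine Finset.sum_congr rfl fun k _ => ?_
      simp only [one_pow, mul_one, neg_pow (X : ℝ[X]), C_mul, C_pow, C_neg, C_1, map_natCast,
        pow_add]
      ring
    rw [hL, hbin, derivative_sum]
    conv_rhs => rw [hIcc]
    rw [Finset.sum_map, Finset.mul_sum]
    refine Finset.sum_congr rfl fun k hk => ?_
    have hk' : k ≤ d := by simpa [Nat.lt_succ_iff] using hk
    simp only [addLeftEmbedding_apply]
    rw [derivative_C_mul_X_pow, ← hIcc]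
    have e : H + 1 + k - 1 = H + k := by omega
    rw [e, mul_comm (∏ j ∈ _, _), mul_prod_erase_div H d hk', ← C_eq_natCast, ← mul_assoc, ← C_mul]
    congr 2
    push_cast; ring
  have h0 : ∀ p : ℝ[X], derivative p = 0 → p.coeff 0 = 0 → p = 0 := by
    intro p hp hc
    rw [eq_C_of_natDegree_eq_zero (derivative_eq_zero.1 hp), hc, C_0]
  rw [← sub_eq_zero]
  -- The constant terms vanish because all indices are at least `h ≥ 1`.
  refine h0 _ (by rw [derivative_sub, hder, sub_self]) ?_
  rw [coeff_sub, finsetSum_coeff, finsetSum_coeff, Finset.sum_eq_zero, Finset.sum_eq_zero,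
    sub_zero]
  · intro i hi
    have : i ≠ 0 := by have := (Finset.mem_Icc.1 hi).1; omega
    simp [coeff_X_pow, this.symm]
  · intro m hm
    have : m ≠ 0 := by have := (Finset.mem_Icc.1 hm).1; omega
    rw [coeff_zero_eq_eval_zero, bernsteinPolynomial.eval_at_0, if_neg this]

theorem sum_choose_mul_pow_Icc {h n : ℕ} (h1 : 1 ≤ h) (hn : h ≤ n) (p : ℝ) :
    ∑ m ∈ Finset.Icc h n, (n.choose m : ℝ) * p ^ m * (1 - p) ^ (n - m) =
      ∑ i ∈ Finset.Icc h n, (∏ j ∈ (Finset.Icc h n).erase i, ((j : ℝ) / ((j : ℝ) - i))) * p ^ i := by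
  have := congrArg (Polynomial.eval p) (sum_bernsteinPolynomial_Icc h1 hn)
  simpa [Polynomial.eval_finsetSum, bernsteinPolynomial, Polynomial.eval_prod] using this

end BinomialTail

/-! ### Path properties of storage and repair. -/

instance : Countable CellNode := by
  refine Function.Injective.countable (β := Bool × ℕ)
    (f := fun v => match v with | .initial j => (true, j) | .arriving j => (false, j)) ?_
  rintro (j | j) (k | k) h <;> simp_all

instance (n : ℕ) : Countable (Clock n) := by
  refine Function.Injective.countable (β := ℕ ⊕ CellNode ⊕ (CellNode × ℕ) ⊕ (Fin n × ℕ))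
    (f := fun c => match c with
      | .interarrival j => .inl j
      | .lifetime v => .inr (.inl v)
      | .request v l => .inr (.inr (.inl (v, l)))
      | .storage i k => .inr (.inr (.inr (i, k)))) ?_
  rintro (j | v | ⟨v, l⟩ | ⟨i, k⟩) (j' | v' | ⟨v', l'⟩ | ⟨i', k'⟩) h <;> simp_all

namespace DSNetwork

variable (S : DSNetwork)

section Paths

variable {x y : Clock S.n → ℝ}

/-- A placement time depends only on the clocks of earlier occupants of the position; hence it is
independent of the clock of the node being placed. -/
theorem placementTime_congr {i : Fin S.n} {k : ℕ}
    (h : ∀ m < k, x (.storage i m) = y (.storage i m)) :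
    S.placementTime x i k = S.placementTime y i k := by
  induction k with
  | zero => rfl
  | succ k ih =>
    rw [placementTime, placementTime, ih fun m hm => h m (by omega), h k (by omega)]

theorem storageCount_congr (h : ∀ i k, x (.storage i k) = y (.storage i k)) (t : ℝ) :
    S.storageCount x t = S.storageCount y t := by
  simp only [storageCount, S.placementTime_congr fun m _ => h _ m, h]

theorem measurable_placementTime (i : Fin S.n) (k : ℕ) :
    Measurable fun x : Clock S.n → ℝ => S.placementTime x i k := by
  induction k with
  | zero => exact measurable_const
  | succ k ih =>
    have h1 : Measurable fun x : Clock S.n → ℝ =>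
        (S.placementTime x i k + x (.storage i k)) / S.Δ :=
      (ih.add (measurable_pi_apply _)).div_const _
    exact ((measurable_from_top (f := fun z : ℤ => (z : ℝ))).comp
      (Int.measurable_ceil.comp h1)).const_mul _

theorem measurable_storageCount :
    Measurable fun p : (Clock S.n → ℝ) × ℝ => S.storageCount p.1 p.2 := by
  refine measurable_ncard_setOf fun i => ?_
  have : {p : (Clock S.n → ℝ) × ℝ | ∃ k, S.placementTime p.1 i k ≤ p.2 ∧
      p.2 < S.placementTime p.1 i k + p.1 (.storage i k)} =
      ⋃ k, {p | S.placementTime p.1 i k ≤ p.2} ∩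
        {p | p.2 < S.placementTime p.1 i k + p.1 (.storage i k)} := by
    ext p; simp
  rw [this]
  refine MeasurableSet.iUnion fun k => ?_
  have h1 := (S.measurable_placementTime i k).comp
    (measurable_fst : Measurable fun p : (Clock S.n → ℝ) × ℝ => p.1)
  exact (measurableSet_le h1 measurable_snd).inter (measurableSet_lt measurable_snd
    (h1.add ((measurable_pi_apply _).comp measurable_fst)))

theorem measurable_requestCost :
    Measurable fun p : (Clock S.n → ℝ) × ℝ => S.requestCost p.1 p.2 :=
  Measurable.ite (S.measurable_storageCount (measurableSet_Ici (a := S.h)))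
    measurable_const measurable_const

theorem measurable_requestClock (v : CellNode) (l : ℕ) :
    Measurable fun x : Clock S.n → ℝ => S.requestClock x v l :=
  Finset.measurable_fun_sum _ fun _ _ => measurable_pi_apply _

theorem measurable_arrivalTime (v : CellNode) :
    Measurable fun x : Clock S.n → ℝ => S.arrivalTime x v := by
  cases v with
  | initial j => exact measurable_const
  | arriving j => exact Finset.measurable_fun_sum _ fun _ _ => measurable_pi_apply _

theorem measurable_requestPhase (v : CellNode) (l : ℕ) :
    Measurable fun x : Clock S.n → ℝ => S.requestPhase x v l :=
  (((S.measurable_requestClock v l).div_const _).fract).const_mul _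

/-- Number of the first `n` storage nodes that are still in the cell at time `t`. -/
noncomputable def survivorCount (x : Clock S.n → ℝ) (t : ℝ) : ℕ :=
  {i : Fin S.n | t < x (.storage i 0)}.ncard

theorem survivorCount_congr (h : ∀ i k, x (.storage i k) = y (.storage i k)) (t : ℝ) :
    S.survivorCount x t = S.survivorCount y t := by
  simp only [survivorCount, h]

theorem measurable_survivorCount :
    Measurable fun p : (Clock S.n → ℝ) × ℝ => S.survivorCount p.1 p.2 :=
  measurable_ncard_setOf fun _ =>
    measurableSet_lt measurable_snd ((measurable_pi_apply _).comp measurable_fst)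

theorem survivorCount_antitone (x : Clock S.n → ℝ) : Antitone (S.survivorCount x) :=
  fun _ _ hst => Set.ncard_le_ncard (fun _ hi => lt_of_le_of_lt hst hi) (Set.toFinite _)

/-- The number of survivors is right-continuous. -/
theorem exists_survivorCount_eq (x : Clock S.n → ℝ) (s : ℝ) :
    ∃ t, s < t ∧ S.survivorCount x t = S.survivorCount x s := by
  have h : ∀ᶠ t in 𝓝[>] s, ∀ i : Fin S.n, s < x (.storage i 0) → t < x (.storage i 0) := by
    refine eventually_all.2 fun i => ?_
    by_cases hi : s < x (.storage i 0)
    · filter_upwards [mem_nhdsWithin_of_mem_nhds (Iio_mem_nhds hi)] with t ht _ using ht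
    · exact Eventually.of_forall fun t h => absurd h hi
  obtain ⟨t, ht, hst⟩ := (h.and self_mem_nhdsWithin).exists
  refine ⟨t, hst, le_antisymm (S.survivorCount_antitone x (le_of_lt hst)) ?_⟩
  exact Set.ncard_le_ncard (fun i hi => ht i hi) (Set.toFinite _)

/-- Right-continuity makes the inequality strict: a count of at least `h` at `s` persists on some
interval after `s`. The set under the infimum must also be nonempty, since `sInf ∅ = 0`. -/
theorem lt_depletionTime_iff (x : Clock S.n → ℝ) {s : ℝ} (hs : 0 ≤ s) :
    s < S.depletionTime x ↔ S.h ≤ S.survivorCount x s := by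
  have hdef : S.depletionTime x = sInf {t | 0 ≤ t ∧ S.survivorCount x t < S.h} := rfl
  have hbdd : BddBelow {t | 0 ≤ t ∧ S.survivorCount x t < S.h} := ⟨0, fun t ht => ht.1⟩
  rw [hdef]
  constructor
  · intro h
    by_contra hc
    exact absurd (csInf_le hbdd ⟨hs, not_le.1 hc⟩) (not_le.2 h)
  · intro h
    obtain ⟨t, hst, ht⟩ := S.exists_survivorCount_eq x s
    have hne : {t | 0 ≤ t ∧ S.survivorCount x t < S.h}.Nonempty := by
      -- A time not before any of the departures, whatever the signs of the clocks; the count there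
      -- is `0 < h`.
      refine ⟨∑ i, |x (.storage i 0)|, Finset.sum_nonneg fun _ _ => abs_nonneg _, ?_⟩
      have : {i : Fin S.n | ∑ j, |x (.storage j 0)| < x (.storage i 0)} = ∅ := by
        refine Set.eq_empty_iff_forall_notMem.2 fun i hi => ?_
        exact absurd hi (not_lt.2 ((le_abs_self _).trans
          (Finset.single_le_sum (f := fun j => |x (.storage j 0)|)
            (fun _ _ => abs_nonneg _) (Finset.mem_univ i))))
      rw [survivorCount, this, Set.ncard_empty]
      exact S.one_le_h
    refine lt_of_lt_of_le hst (le_csInf hne fun u hu => ?_)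
    by_contra hc
    have := S.survivorCount_antitone x (not_le.1 hc).le
    have := hu.2
    omega

theorem exists_placementTime_eq (x : Clock S.n → ℝ) (i : Fin S.n) (k : ℕ) :
    ∃ z : ℤ, S.placementTime x i k = S.Δ * z := by
  cases k with
  | zero => exact ⟨0, by simp [placementTime]⟩
  | succ k => exact ⟨_, rfl⟩

theorem departure_le_placementTime_succ (x : Clock S.n → ℝ) (i : Fin S.n) (k : ℕ) :
    S.placementTime x i k + x (.storage i k) ≤ S.placementTime x i (k + 1) := by
  rw [placementTime, mul_comm]
  exact (div_le_iff₀ S.Δ_pos).1 (Int.le_ceil _)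

/-- Successive placement times are distinct multiples of `Δ` when lifetimes are positive. Hence they
grow at least linearly, and only finitely many precede a given repair. -/
theorem add_le_placementTime_succ {i : Fin S.n} (hx : ∀ k, 0 < x (.storage i k)) (k : ℕ) :
    S.placementTime x i k + S.Δ ≤ S.placementTime x i (k + 1) := by
  have h1 : S.placementTime x i k < S.placementTime x i (k + 1) :=
    lt_of_lt_of_le (by linarith [hx k]) (S.departure_le_placementTime_succ x i k)
  obtain ⟨a, ha⟩ := S.exists_placementTime_eq x i k
  obtain ⟨b, hb⟩ := S.exists_placementTime_eq x i (k + 1)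
  rw [ha, hb] at h1 ⊢
  have h2 : (a : ℝ) < b := lt_of_mul_lt_mul_left h1 S.Δ_pos.le
  have h3 : (a : ℝ) + 1 ≤ b := by exact_mod_cast Int.add_one_le_iff.2 (by exact_mod_cast h2)
  nlinarith [S.Δ_pos]

theorem placementTime_mono {i : Fin S.n} (hx : ∀ k, 0 < x (.storage i k)) :
    Monotone (S.placementTime x i) :=
  monotone_nat_of_le_succ fun k => by linarith [S.add_le_placementTime_succ hx k, S.Δ_pos]

theorem mul_le_placementTime {i : Fin S.n} (hx : ∀ k, 0 < x (.storage i k)) (k : ℕ) :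
    k * S.Δ ≤ S.placementTime x i k := by
  induction k with
  | zero => simp [placementTime]
  | succ k ih =>
    have := S.add_le_placementTime_succ hx k
    push_cast
    linarith

/-- No node is placed strictly between two consecutive repair instants. -/
theorem placementTime_le_iff (x : Clock S.n → ℝ) (i : Fin S.n) (k q : ℕ) {s : ℝ}
    (hs : 0 ≤ s) (hs' : s < S.Δ) :
    S.placementTime x i k ≤ q * S.Δ + s ↔ S.placementTime x i k ≤ q * S.Δ := by
  obtain ⟨a, ha⟩ := S.exists_placementTime_eq x i k
  rw [ha]
  constructor
  · intro h
    have h1 : S.Δ * (a : ℝ) < S.Δ * (q + 1) := by linarith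
    have h2 : (a : ℝ) < q + 1 := lt_of_mul_lt_mul_left h1 S.Δ_pos.le
    have h3 : a ≤ q := by
      have : a < (q : ℤ) + 1 := by exact_mod_cast h2
      omega
    have h4 : (a : ℝ) ≤ q := by exact_mod_cast h3
    nlinarith [S.Δ_pos]
  · intro h; linarith

/-- At each repair instant all storage positions are filled. -/
theorem exists_placed_at_repair {i : Fin S.n} (hx : ∀ k, 0 < x (.storage i k)) (q : ℕ) :
    ∃ k, S.placementTime x i k ≤ q * S.Δ ∧
      q * S.Δ < S.placementTime x i k + x (.storage i k) := by
  classical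
  -- The occupant at time `q * Δ` is the last node placed by then, the predecessor of the first one
  -- placed later. Had it left by `q * Δ`, its successor would already have been placed.
  have hex : ∃ k, q * S.Δ < S.placementTime x i k := by
    refine ⟨q + 1, lt_of_lt_of_le ?_ (S.mul_le_placementTime hx (q + 1))⟩
    push_cast
    linarith [S.Δ_pos]
  obtain ⟨k, hk⟩ : ∃ k, Nat.find hex = k + 1 := by
    refine Nat.exists_eq_succ_of_ne_zero fun h0 => ?_
    have h1 := Nat.find_spec hex
    rw [h0, placementTime] at h1
    have : 0 ≤ (q : ℝ) * S.Δ := mul_nonneg (Nat.cast_nonneg _) S.Δ_pos.le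
    linarith
  have h1 := Nat.find_spec hex
  have h2 := not_lt.1 (Nat.find_min hex (m := k) (by omega))
  rw [hk] at h1
  refine ⟨k, h2, ?_⟩
  by_contra hc
  have h3 : (S.placementTime x i k + x (.storage i k)) / S.Δ ≤ q :=
    (div_le_iff₀ S.Δ_pos).2 (not_lt.1 hc)
  have h4 : ⌈(S.placementTime x i k + x (.storage i k)) / S.Δ⌉ ≤ (q : ℤ) :=
    Int.ceil_le.2 (by exact_mod_cast h3)
  have h5 : ((⌈(S.placementTime x i k + x (.storage i k)) / S.Δ⌉ : ℤ) : ℝ) ≤ q := by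
    exact_mod_cast h4
  rw [placementTime] at h1
  nlinarith [S.Δ_pos]

end Paths

end DSNetwork

/-! ### Memorylessness and the law of the number of storage nodes. -/

theorem measure_lt_of_map_eq_expMeasure {Ω : Type*} [MeasurableSpace Ω] {P : Measure Ω} {V : Ω → ℝ}
    (hV : Measurable V) {r : ℝ} (hr : 0 < r) (hVr : P.map V = expMeasure r) {t : ℝ} (ht : 0 ≤ t) :
    P {ξ | t < V ξ} = ENNReal.ofReal (Real.exp (-(r * t))) := by
  rw [← expMeasure_Ioi hr ht, ← hVr, Measure.map_apply hV measurableSet_Ioi]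
  rfl

/-- Memorylessness: an exponential time started at an independent time `T` before `a` and still
running at time `a` lasts for another time `u` with probability `exp (-(r * u))`. -/
theorem measure_exponential_memoryless {Ω : Type*} [MeasurableSpace Ω] {P : Measure Ω}
    [IsProbabilityMeasure P] {T V : Ω → ℝ} (hT : Measurable T) (hV : Measurable V)
    (hTV : IndepFun T V P) {r : ℝ} (hr : 0 < r) (hVr : P.map V = expMeasure r) (a : ℝ) {u : ℝ}
    (hu : 0 ≤ u) :
    P {ξ | T ξ ≤ a ∧ a + u < T ξ + V ξ} =
      ENNReal.ofReal (Real.exp (-(r * u))) * P {ξ | T ξ ≤ a ∧ a < T ξ + V ξ} := by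
  -- Integrating out `V` gives the tail at `a + u - T`, from which `exp (-(r * u))` splits off. The
  -- remaining integral does not involve `u` and is identified by taking `u = 0`.
  have key : ∀ u, 0 ≤ u → P {ξ | T ξ ≤ a ∧ a + u < T ξ + V ξ} =
      ENNReal.ofReal (Real.exp (-(r * u))) * ∫⁻ ξ, {ξ | T ξ ≤ a}.indicator
        (fun ξ => ENNReal.ofReal (Real.exp (-(r * (a - T ξ))))) ξ ∂P := by
    intro u hu
    have hmF : MeasurableSet {p : ℝ × ℝ | p.1 ≤ a ∧ a + u < p.1 + p.2} :=
      (measurableSet_le measurable_fst measurable_const).inter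
        (measurableSet_lt measurable_const (measurable_fst.add measurable_snd))
    have hms : MeasurableSet {ξ | T ξ ≤ a ∧ a + u < T ξ + V ξ} := (hT.prodMk hV) hmF
    have h1 := lintegral_of_indepFun hT hV hTV
      (F := fun b c => {p : ℝ × ℝ | p.1 ≤ a ∧ a + u < p.1 + p.2}.indicator 1 (b, c))
      (measurable_one.indicator hmF)
    have h2 : ∫⁻ ξ, {p : ℝ × ℝ | p.1 ≤ a ∧ a + u < p.1 + p.2}.indicator (1 : ℝ × ℝ → ℝ≥0∞)
        (T ξ, V ξ) ∂P = P {ξ | T ξ ≤ a ∧ a + u < T ξ + V ξ} := by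
      rw [← lintegral_indicator_one hms]
      rfl
    rw [← h2, h1, ← lintegral_const_mul' _ _ ENNReal.ofReal_ne_top]
    refine lintegral_congr fun ξ => ?_
    by_cases hξ : T ξ ≤ a
    · have h3 := measure_lt_of_map_eq_expMeasure hV hr hVr (t := a + u - T ξ) (by linarith)
      have h4 : ∀ ξ', {p : ℝ × ℝ | p.1 ≤ a ∧ a + u < p.1 + p.2}.indicator (1 : ℝ × ℝ → ℝ≥0∞)
          (T ξ, V ξ') = {ξ' | a + u - T ξ < V ξ'}.indicator 1 ξ' := by
        intro ξ'
        simp only [Set.indicator, Set.mem_ofPred_eq, hξ, true_and, sub_lt_iff_lt_add',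
          Pi.one_apply]
      simp_rw [h4]
      rw [lintegral_indicator_one (measurableSet_lt measurable_const hV), h3]
      simp only [Set.indicator, Set.mem_ofPred_eq, hξ, if_true]
      rw [← ENNReal.ofReal_mul (Real.exp_pos _).le, ← Real.exp_add]
      congr 2
      ring
    · simp [hξ]
  have h0 := key 0 le_rfl
  simp only [add_zero, mul_zero, neg_zero, Real.exp_zero, ENNReal.ofReal_one, one_mul] at h0
  rw [key u hu, h0]

namespace DSNetwork

variable {S : DSNetwork} {Ω : Type*} [MeasurableSpace Ω] {P : Measure Ω}
  {X : Clock S.n → Ω → ℝ} {K : Ω → ℕ}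

theorem rate_pos (c : Clock S.n) : 0 < S.rate c := by
  cases c
  · exact mul_pos S.N_pos S.μ_pos
  · exact S.μ_pos
  · exact S.ω_pos
  · exact S.μ_pos

namespace IsModel

variable (hX : S.IsModel P X K) (mX : ∀ c, Measurable (X c))

include hX mX

theorem isExpWalk {k : ℕ → Clock S.n} (hk : Function.Injective k) {r : ℝ}
    (hr : ∀ l, S.rate (k l) = r) : IsExpWalk P r fun l => X (k l) where
  rate_pos := hr 0 ▸ S.rate_pos (k 0)
  measurable l := mX _
  map_eq l := by rw [(hX.hasLaw_clock (k l)).map_eq, hr]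
  indep L := by
    have := (hX.iIndepFun_clock.precomp hk).indepFun_sum_range_succ (fun l => mX _) L
    convert! this using 1
    ext ξ; simp

theorem ae_pos : ∀ᵐ ξ ∂P, ∀ c, 0 < X c ξ := by
  refine ae_all_iff.2 fun c => ?_
  have := ae_expMeasure_pos (S.rate_pos c)
  rw [← (hX.hasLaw_clock c).map_eq] at this
  exact ae_of_ae_map (mX c).aemeasurable this

theorem indepFun_clocks_of_disjoint {β γ : Type*} [MeasurableSpace β] [MeasurableSpace γ]
    {s t : Set (Clock S.n)} (hst : Disjoint s t)
    {F : (Clock S.n → ℝ) → β} {G : (Clock S.n → ℝ) → γ} (hF : Measurable F) (hG : Measurable G)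
    (hFs : ∀ x, F (s.indicator x) = F x) (hGt : ∀ x, G (t.indicator x) = G x) :
    IndepFun (fun ξ => F fun c => X c ξ) (fun ξ => G fun c => X c ξ) P :=
  indepFun_of_disjoint mX hX.iIndepFun_clock hst hF hG hFs hGt

variable [IsProbabilityMeasure P]

/-- A storage position is filled at time `s` after a repair with probability `exp (-(μ * s))`. -/
theorem measureReal_filled (i : Fin S.n) (q : ℕ) {s : ℝ} (hs : 0 ≤ s) (hs' : s < S.Δ) :
    P.real {ξ | ∃ k, S.placementTime (fun c => X c ξ) i k ≤ q * S.Δ + s ∧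
      q * S.Δ + s < S.placementTime (fun c => X c ξ) i k + X (.storage i k) ξ} =
      Real.exp (-(S.μ * s)) := by
  let T : ℕ → Ω → ℝ := fun k ξ => S.placementTime (fun c => X c ξ) i k
  -- `B u k`: the `k`-th node of the position was placed by the repair at `q * Δ` and is still there
  -- at `q * Δ + u`. For fixed `u ≥ 0` these events are almost surely disjoint, since a node is
  -- placed only after its predecessor has left.
  let B : ℝ → ℕ → Set Ω := fun u k =>
    {ξ | T k ξ ≤ q * S.Δ ∧ q * S.Δ + u < T k ξ + X (.storage i k) ξ}
  have hT : ∀ k, Measurable (T k) := fun k =>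
    (S.measurable_placementTime i k).comp (measurable_pi_lambda _ mX)
  have hB : ∀ u k, MeasurableSet (B u k) := fun u k =>
    (measurableSet_le (hT k) measurable_const).inter
      (measurableSet_lt measurable_const ((hT k).add (mX _)))
  have hBu : ∀ u, 0 ≤ u → P (⋃ k, B u k) = ∑' k, P (B u k) := by
    intro u hu
    refine measure_iUnion₀ (fun k l hkl => ?_) fun k => (hB u k).nullMeasurableSet
    refine measure_eq_zero_iff_ae_notMem.2 ?_
    filter_upwards [hX.ae_pos mX] with ξ hξ
    have hmono := S.placementTime_mono (x := fun c => X c ξ) (i := i) fun k => hξ _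
    have hlt : ∀ a b : ℕ, a < b → ξ ∈ B u a → ξ ∈ B u b → False := by
      rintro a b hab ⟨_, h1⟩ ⟨h2, _⟩
      have h3 := S.departure_le_placementTime_succ (fun c => X c ξ) i a
      have h4 : S.placementTime _ i (a + 1) ≤ S.placementTime (fun c => X c ξ) i b :=
        hmono (by omega)
      simp only [T] at h1 h2
      linarith
    rintro ⟨h1, h2⟩
    rcases lt_or_gt_of_ne hkl with h | h
    · exact hlt _ _ h h1 h2
    · exact hlt _ _ h h2 h1
  have hmem : ∀ k, P (B s k) = ENNReal.ofReal (Real.exp (-(S.μ * s))) * P (B 0 k) := by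
    intro k
    have hd : Disjoint {c : Clock S.n | ∃ m < k, c = .storage i m} {.storage i k} := by
      rw [Set.disjoint_singleton_right]
      rintro ⟨m, hm, h⟩
      simp only [Clock.storage.injEq, true_and] at h
      omega
    have hind : IndepFun (T k) (X (.storage i k)) P := by
      refine hX.indepFun_clocks_of_disjoint mX hd (S.measurable_placementTime i k)
        (G := fun x => x (.storage i k)) (measurable_pi_apply _) (fun x => ?_) fun x => ?_
      · refine S.placementTime_congr fun m hm => ?_
        exact Set.indicator_of_mem (s := {c : Clock S.n | ∃ m < k, c = .storage i m})
          ⟨m, hm, rfl⟩ x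
      · exact Set.indicator_of_mem (Set.mem_singleton _) x
    have h := measure_exponential_memoryless (hT k) (mX (.storage i k)) hind S.μ_pos
      (hX.hasLaw_clock (.storage i k)).map_eq (q * S.Δ) hs
    simpa only [B, add_zero] using h
  -- The position is almost surely filled at the repair, so summing `hmem` over `k` leaves only the
  -- exponential factor.
  have hone : P (⋃ k, B 0 k) = 1 := by
    refine mem_ae_iff_prob_eq_one (MeasurableSet.iUnion (hB 0)) |>.1 ?_
    filter_upwards [hX.ae_pos mX] with ξ hξ
    obtain ⟨k, hk⟩ := S.exists_placed_at_repair (x := fun c => X c ξ) (i := i) (fun k => hξ _) q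
    exact Set.mem_iUnion.2 ⟨k, by simpa [B, T] using hk⟩
  have hset : {ξ | ∃ k, S.placementTime (fun c => X c ξ) i k ≤ q * S.Δ + s ∧
      q * S.Δ + s < S.placementTime (fun c => X c ξ) i k + X (.storage i k) ξ} = ⋃ k, B s k := by
    ext ξ
    simp [B, T, S.placementTime_le_iff _ _ _ _ hs hs']
  rw [hset, measureReal_def, hBu s hs]
  simp_rw [hmem]
  rw [ENNReal.tsum_mul_left, ← hBu 0 le_rfl, hone, mul_one,
    ENNReal.toReal_ofReal (Real.exp_pos _).le]

end IsModel

/-- Probability that `n` storage nodes are not depleted by time `s`. -/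
noncomputable def survival (S : DSNetwork) (s : ℝ) : ℝ :=
  ∑ i ∈ Finset.Icc S.h S.n,
    (∏ j ∈ (Finset.Icc S.h S.n).erase i, ((j : ℝ) / ((j : ℝ) - i))) * Real.exp (-(S.μ * s)) ^ i

namespace IsModel

variable [IsProbabilityMeasure P] (hX : S.IsModel P X K) (mX : ∀ c, Measurable (X c))

theorem storage_rows_disjoint :
    Pairwise (Function.onFun Disjoint fun i : Fin S.n => Set.range (Clock.storage i)) := by
  intro i j hij
  refine Set.disjoint_left.2 ?_
  rintro _ ⟨k, rfl⟩ ⟨l, h⟩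
  simp only [Clock.storage.injEq] at h
  exact hij h.1.symm

include hX mX

/-- Only the probability of each position and its dependence on its own row of clocks matter. This
is why the system with repairs and the one without share the function `survival`. -/
theorem measureReal_le_ncard_storage {A : Fin S.n → Set (Clock S.n → ℝ)}
    (hA : ∀ i, MeasurableSet (A i))
    (hAi : ∀ i x, (Set.range (Clock.storage i)).indicator x ∈ A i ↔ x ∈ A i) {s : ℝ}
    (hs : ∀ i, P.real {ξ | (fun c => X c ξ) ∈ A i} = Real.exp (-(S.μ * s))) :
    P.real {ξ | S.h ≤ {i | (fun c => X c ξ) ∈ A i}.ncard} = S.survival s := by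
  have h1 := measureReal_le_ncard (P := P)
    (g := fun i ξ => (Set.range (Clock.storage i)).indicator fun c => X c ξ)
    (fun i => (measurable_set_indicator _).comp (measurable_pi_lambda _ mX))
    (iIndepFun_indicator_of_pairwise_disjoint mX hX.iIndepFun_clock storage_rows_disjoint)
    hA (p := Real.exp (-(S.μ * s))) (fun i => by rw [← hs i]; congr 1; ext ξ; exact hAi i _) S.h
  simp only [hAi] at h1
  rw [h1, sum_choose_mul_pow_Icc S.one_le_h S.h_le_n]
  rfl

theorem measureReal_le_storageCount (q : ℕ) {s : ℝ} (hs : 0 ≤ s) (hs' : s < S.Δ) :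
    P.real {ξ | S.h ≤ S.storageCount (fun c => X c ξ) (q * S.Δ + s)} = S.survival s := by
  refine hX.measureReal_le_ncard_storage mX
    (A := fun i => {x | ∃ k, S.placementTime x i k ≤ q * S.Δ + s ∧
      q * S.Δ + s < S.placementTime x i k + x (.storage i k)}) (fun i => ?_) (fun i x => ?_)
    fun i => hX.measureReal_filled mX i q hs hs'
  · have : {x : Clock S.n → ℝ | ∃ k, S.placementTime x i k ≤ q * S.Δ + s ∧
      q * S.Δ + s < S.placementTime x i k + x (.storage i k)} =
      ⋃ k, {x | S.placementTime x i k ≤ q * S.Δ + s} ∩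
        {x | q * S.Δ + s < S.placementTime x i k + x (.storage i k)} := by
      ext x; simp
    rw [this]
    exact MeasurableSet.iUnion fun k =>
      (measurableSet_le (S.measurable_placementTime i k) measurable_const).inter
        (measurableSet_lt measurable_const
          ((S.measurable_placementTime i k).add (measurable_pi_apply _)))
  · have h : ∀ k, (Set.range (Clock.storage i)).indicator x (.storage i k) = x (.storage i k) :=
      fun k => Set.indicator_of_mem (Set.mem_range_self k) x
    simp only [Set.mem_ofPred_eq, h, S.placementTime_congr fun m _ => h m]

theorem measureReal_le_survivorCount {s : ℝ} (hs : 0 ≤ s) :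
    P.real {ξ | S.h ≤ S.survivorCount (fun c => X c ξ) s} = S.survival s := by
  refine hX.measureReal_le_ncard_storage mX (A := fun i => {x | s < x (.storage i 0)})
    (fun i => measurableSet_lt measurable_const (measurable_pi_apply _)) (fun i x => ?_) fun i => ?_
  · have h : (Set.range (Clock.storage i)).indicator x (.storage i 0) = x (.storage i 0) :=
      Set.indicator_of_mem (Set.mem_range_self 0) x
    simp only [Set.mem_ofPred_eq, h]
  · have := measure_lt_of_map_eq_expMeasure (mX (.storage i 0)) S.μ_pos
      (hX.hasLaw_clock (.storage i 0)).map_eq hs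
    simp only [Set.mem_ofPred_eq, measureReal_def, this, ENNReal.toReal_ofReal (Real.exp_pos _).le]

end IsModel

theorem continuous_survival (S : DSNetwork) : Continuous S.survival := by
  unfold survival
  fun_prop

/-- The long-run probability of D2D download. -/
noncomputable def d2dProb (S : DSNetwork) : ℝ := (1 / S.Δ) * ∫ s in (0 : ℝ)..S.Δ, S.survival s

theorem d2dProb_eq (S : DSNetwork) : S.d2dProb = (1 / S.Δ) *
    ∑ i ∈ Finset.Icc S.h S.n, (1 - Real.exp (-S.deathRate i * S.Δ)) / S.deathRate i *
      ∏ j ∈ (Finset.Icc S.h S.n).erase i, S.deathRate j / (S.deathRate j - S.deathRate i) := by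
  unfold d2dProb survival
  congr 1
  rw [intervalIntegral.integral_finsetSum fun i _ =>
    (by fun_prop : Continuous _).intervalIntegrable _ _]
  refine Finset.sum_congr rfl fun i hi => ?_
  have hi0 : (i : ℝ) ≠ 0 := by
    have := (Finset.mem_Icc.1 hi).1
    have := S.one_le_h
    exact_mod_cast (by omega : i ≠ 0)
  have hr : S.deathRate i ≠ 0 := mul_ne_zero hi0 S.μ_pos.ne'
  have hexp : ∀ s, Real.exp (-(S.μ * s)) ^ i = Real.exp (-S.deathRate i * s) := by
    intro s
    rw [← Real.exp_nat_mul, deathRate]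
    congr 1; ring
  simp_rw [hexp]
  have hint : ∫ s in (0 : ℝ)..S.Δ, Real.exp (-S.deathRate i * s) =
      (1 - Real.exp (-S.deathRate i * S.Δ)) / S.deathRate i := by
    rw [intervalIntegral.integral_comp_mul_left (fun s => Real.exp s) (neg_ne_zero.2 hr),
      integral_exp, mul_zero, Real.exp_zero, smul_eq_mul, inv_neg]
    field_simp
    ring
  have hprod : ∀ j ∈ (Finset.Icc S.h S.n).erase i,
      (j : ℝ) / ((j : ℝ) - i) = S.deathRate j / (S.deathRate j - S.deathRate i) := by
    intro j _
    rw [deathRate, deathRate, ← sub_mul, mul_div_mul_right _ _ S.μ_pos.ne']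
  rw [intervalIntegral.integral_const_mul, hint, Finset.prod_congr rfl hprod, mul_comm]

end DSNetwork

/-! ### Long-run averages of the download probabilities. -/

/-- The integral of a periodic function with values in `[0, 1]` differs from its mean value times
the length by at most a period. -/
theorem abs_integral_sub_mean_le {g : ℝ → ℝ} {D : ℝ} (hD : 0 < D) (hg : Function.Periodic g D)
    (hgm : Measurable g) (h0 : ∀ t, 0 ≤ g t) (h1 : ∀ t, g t ≤ 1) (T : ℝ) :
    |(∫ t in (0 : ℝ)..T, g t) - T * ((1 / D) * ∫ t in (0 : ℝ)..D, g t)| ≤ D := by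
  set d := (1 / D) * ∫ t in (0 : ℝ)..D, g t with hd
  have hgi : ∀ a b : ℝ, IntervalIntegrable g volume a b := by
    intro a b
    refine (intervalIntegrable_const (c := (1 : ℝ))).mono_fun hgm.aestronglyMeasurable ?_
    refine ae_of_all _ fun t => ?_
    simp [abs_of_nonneg (h0 t), h1 t]
  have hD' : ∫ t in (0 : ℝ)..D, g t = D * d := by rw [hd]; field_simp
  -- The deviation is itself periodic, so `T` may be moved into `[0, D)`, where both the integral
  -- and `T * d` lie between `0` and `T`.
  have hG : Function.Periodic (fun T => (∫ t in (0 : ℝ)..T, g t) - T * d) D := by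
    intro T
    have h2 := hg.intervalIntegral_add_eq T 0
    have h3 := intervalIntegral.integral_add_adjacent_intervals (hgi 0 T) (hgi T (T + D))
    rw [zero_add] at h2
    simp only
    rw [← h3, h2, hD']
    ring
  obtain ⟨s, hs, hTs⟩ := hG.exists_mem_Ico₀ hD T
  have hTs' : (∫ t in (0 : ℝ)..T, g t) - T * d = (∫ t in (0 : ℝ)..s, g t) - s * d := hTs
  rw [hTs']
  have hb : ∀ s, 0 ≤ s → 0 ≤ ∫ t in (0 : ℝ)..s, g t ∧ ∫ t in (0 : ℝ)..s, g t ≤ s := by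
    intro s hs
    refine ⟨intervalIntegral.integral_nonneg hs fun t _ => h0 t, ?_⟩
    have := intervalIntegral.integral_mono hs (hgi 0 s)
      (intervalIntegrable_const (c := (1 : ℝ))) h1
    simpa using this
  have hs1 := hb s hs.1
  have hD1 := hb D hD.le
  rw [hD'] at hD1
  have hd0 : 0 ≤ d := by
    by_contra h
    nlinarith [hD1.1]
  have hd1 : d ≤ 1 := by
    by_contra h
    nlinarith [hD1.2]
  have h5 : s * d ≤ s := by nlinarith [hs.1]
  have h6 : 0 ≤ s * d := mul_nonneg hs.1 hd0
  rw [abs_le]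
  constructor <;> linarith [hs.2]

theorem indicator_one_eq_of_mem_iff {α β : Type*} {A : Set α} {B : Set β} {a : α} {b : β}
    (h : a ∈ A ↔ b ∈ B) : A.indicator (1 : α → ℝ≥0∞) a = B.indicator (1 : β → ℝ≥0∞) b := by
  by_cases ha : a ∈ A
  · rw [Set.indicator_of_mem ha, Set.indicator_of_mem (h.1 ha), Pi.one_apply, Pi.one_apply]
  · rw [Set.indicator_of_notMem ha, Set.indicator_of_notMem (mt h.2 ha)]

namespace DSNetwork

variable {S : DSNetwork} {Ω : Type*} [MeasurableSpace Ω] {P : Measure Ω} [IsProbabilityMeasure P]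
  {X : Clock S.n → Ω → ℝ} {K : Ω → ℕ}

namespace IsModel

variable (hX : S.IsModel P X K) (mX : ∀ c, Measurable (X c))

include hX mX

/-- Integrating out the storage clocks. -/
theorem lintegral_storage {β : Type*} [MeasurableSpace β] {U : (Clock S.n → ℝ) → β}
    (hU : Measurable U) {F : β → (Clock S.n → ℝ) → ℝ≥0∞} (hF : Measurable (Function.uncurry F))
    (hUs : ∀ x y : Clock S.n → ℝ, (∀ c, (∀ i k, c ≠ .storage i k) → x c = y c) → U x = U y)
    (hFs : ∀ b (x y : Clock S.n → ℝ), (∀ i k, x (.storage i k) = y (.storage i k)) →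
      F b x = F b y) :
    ∫⁻ ξ, F (U fun c => X c ξ) (fun c => X c ξ) ∂P =
      ∫⁻ ξ, ∫⁻ ξ', F (U fun c => X c ξ) (fun c => X c ξ') ∂P ∂P := by
  let A : Set (Clock S.n) := {c | ∃ i k, c = .storage i k}
  have hA : ∀ (x : Clock S.n → ℝ) i k, A.indicator x (.storage i k) = x (.storage i k) :=
    fun x i k => Set.indicator_of_mem (s := A) ⟨i, k, rfl⟩ x
  have hind : IndepFun (fun ξ => U fun c => X c ξ) (fun ξ => A.indicator fun c => X c ξ) P := by
    refine hX.indepFun_clocks_of_disjoint mX (disjoint_compl_left (a := A)) hU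
      (measurable_set_indicator A) (fun x => hUs _ _ fun c hc => ?_) fun x => ?_
    · refine Set.indicator_of_mem (s := Aᶜ) ?_ x
      rintro ⟨i, k, h⟩
      exact hc i k h
    · rw [Set.indicator_indicator, Set.inter_self]
  have hm : Measurable fun ξ c => X c ξ := measurable_pi_lambda _ mX
  have h := lintegral_of_indepFun (hU.comp hm) ((measurable_set_indicator A).comp hm) hind hF
  have e : ∀ b ξ, F b (A.indicator fun c => X c ξ) = F b fun c => X c ξ :=
    fun b ξ => hFs b _ _ fun i k => hA _ i k
  simpa only [Function.comp_def, e] using h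

/-- The alternating sum that defines `survival` has no visible sign; its bounds come from its being
a probability in the model. -/
theorem survival_nonneg {s : ℝ} (hs : 0 ≤ s) : 0 ≤ S.survival s := by
  rw [← hX.measureReal_le_survivorCount mX hs]
  exact measureReal_nonneg

theorem survival_le_one {s : ℝ} (hs : 0 ≤ s) : S.survival s ≤ 1 := by
  rw [← hX.measureReal_le_survivorCount mX hs]
  exact measureReal_le_one

omit hX mX [IsProbabilityMeasure P] in
theorem phase_nonneg (t : ℝ) : 0 ≤ S.Δ * Int.fract (t / S.Δ) :=
  mul_nonneg S.Δ_pos.le (Int.fract_nonneg _)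

omit hX in
theorem measurableSet_requestPhase_lt (v : CellNode) (l : ℕ) :
    MeasurableSet {ξ | S.requestPhase (fun c => X c ξ) v l < S.depletionTime fun c => X c ξ} := by
  have hm : Measurable fun ξ c => X c ξ := measurable_pi_lambda _ mX
  have : {ξ | S.requestPhase (fun c => X c ξ) v l < S.depletionTime fun c => X c ξ} =
      {ξ | S.h ≤ S.survivorCount (fun c => X c ξ) (S.requestPhase (fun c => X c ξ) v l)} := by
    ext ξ
    exact S.lt_depletionTime_iff _ (phase_nonneg _)
  rw [this]
  exact (S.measurable_survivorCount.comp (hm.prodMk ((S.measurable_requestPhase v l).comp hm)))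
    (measurableSet_Ici (a := S.h))

/-- Request clocks are independent of storage clocks, so the storage side can be averaged at a fixed
phase. -/
theorem measure_requestPhase_lt (v : CellNode) (l : ℕ) :
    P {ξ | S.requestPhase (fun c => X c ξ) v l < S.depletionTime fun c => X c ξ} =
      ∫⁻ ξ, ENNReal.ofReal (S.survival (S.Δ * Int.fract
        ((∑ i ∈ Finset.range l, X (.request v i) ξ) / S.Δ))) ∂P := by
  have hD : MeasurableSet {p : ℝ × (Clock S.n → ℝ) | S.h ≤ S.survivorCount p.2 p.1} :=
    (S.measurable_survivorCount.comp measurable_swap) (measurableSet_Ici (a := S.h))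
  have hin : ∀ b, 0 ≤ b → ∫⁻ ξ', {p : ℝ × (Clock S.n → ℝ) |
      S.h ≤ S.survivorCount p.2 p.1}.indicator (1 : ℝ × (Clock S.n → ℝ) → ℝ≥0∞)
      (b, fun c => X c ξ') ∂P = ENNReal.ofReal (S.survival b) := by
    intro b hb
    have hm : MeasurableSet {ξ' | S.h ≤ S.survivorCount (fun c => X c ξ') b} :=
      (measurable_const.prodMk (measurable_pi_lambda _ mX)) hD
    rw [← hX.measureReal_le_survivorCount mX hb, ofReal_measureReal, ← lintegral_indicator_one hm]
    exact lintegral_congr fun ξ' => indicator_one_eq_of_mem_iff Iff.rfl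
  have h := hX.lintegral_storage mX (S.measurable_requestPhase v l)
    (F := fun a y => {p : ℝ × (Clock S.n → ℝ) | S.h ≤ S.survivorCount p.2 p.1}.indicator 1 (a, y))
    (measurable_one.indicator hD) (fun x y hxy => ?_) fun b x y hxy => ?_
  · rw [← lintegral_indicator_one (measurableSet_requestPhase_lt mX v l)]
    refine Eq.trans (lintegral_congr fun ξ => ?_)
      (h.trans (lintegral_congr fun ξ => hin _ (phase_nonneg _)))
    exact indicator_one_eq_of_mem_iff (S.lt_depletionTime_iff _ (phase_nonneg _))
  · have : ∀ i, x (.request v i) = y (.request v i) := fun i => hxy _ (by simp)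
    simp only [requestPhase, requestClock, this]
  · exact indicator_one_eq_of_mem_iff
      (show S.h ≤ S.survivorCount x b ↔ S.h ≤ S.survivorCount y b by rw [S.survivorCount_congr hxy])

/-- The error bound does not depend on `L`: it is `ω` times the bound `Δ` for the deviation of a
periodic integral from its mean. -/
theorem abs_sum_measureReal_requestPhase_lt (v : CellNode) (L : ℕ) :
    |∑ l ∈ Finset.Icc 1 L, P.real {ξ | S.requestPhase (fun c => X c ξ) v l <
      S.depletionTime fun c => X c ξ} - L * S.d2dProb| ≤ S.ω * S.Δ := by
  set φ : ℝ → ℝ := fun t => S.survival (S.Δ * Int.fract (t / S.Δ)) with hφ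
  have hφ0 : ∀ t, 0 ≤ φ t := fun t => hX.survival_nonneg mX (phase_nonneg t)
  have hφ1 : ∀ t, φ t ≤ 1 := fun t => hX.survival_le_one mX (phase_nonneg t)
  have hφm : Measurable φ :=
    S.continuous_survival.measurable.comp ((measurable_id.div_const _).fract.const_mul _)
  have hφp : Function.Periodic φ S.Δ := by
    intro t
    simp only [hφ, add_div, div_self S.Δ_pos.ne', Int.fract_add_one]
  have hd : (1 / S.Δ) * ∫ t in (0 : ℝ)..S.Δ, φ t = S.d2dProb := by
    rw [d2dProb]
    congr 1
    -- Equality fails to be automatic only at `t = Δ`, whose phase is `0`.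
    refine intervalIntegral.integral_congr_ae ?_
    filter_upwards [Measure.ae_ne volume S.Δ] with t ht htm
    rw [Set.uIoc_of_le S.Δ_pos.le] at htm
    have h1 : t / S.Δ < 1 := (div_lt_one S.Δ_pos).2 (lt_of_le_of_ne htm.2 ht)
    have h2 : 0 ≤ t / S.Δ := div_nonneg htm.1.le S.Δ_pos.le
    simp only [hφ, Int.fract_eq_self.2 ⟨h2, h1⟩, mul_div_cancel₀ t S.Δ_pos.ne']
  have hd0 : 0 ≤ S.d2dProb := by
    rw [← hd]
    exact mul_nonneg (one_div_nonneg.2 S.Δ_pos.le)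
      (intervalIntegral.integral_nonneg S.Δ_pos.le fun t _ => hφ0 t)
  have hI : ∀ T, 0 ≤ T → ∫⁻ t in Set.Ioc 0 T, ENNReal.ofReal (φ t) =
      ENNReal.ofReal (∫ t in (0 : ℝ)..T, φ t) := by
    intro T hT
    rw [intervalIntegral.integral_of_le hT, ofReal_integral_eq_lintegral_ofReal]
    · refine (integrable_const (1 : ℝ)).mono' hφm.aestronglyMeasurable (ae_of_all _ fun t => ?_)
      rw [Real.norm_eq_abs, abs_of_nonneg (hφ0 t)]
      exact hφ1 t
    · exact ae_of_all _ hφ0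
  have hw : IsExpWalk P S.ω fun i => X (.request v i) :=
    hX.isExpWalk mX (k := fun i => .request v i) (fun a b h => by simpa using h) fun _ => rfl
  have hW0 : ∀ᵐ ξ ∂P, 0 ≤ ∑ i ∈ Finset.range L, X (.request v i) ξ := by
    filter_upwards [hX.ae_pos mX] with ξ hξ
    exact Finset.sum_nonneg fun i _ => (hξ _).le
  have hmW := (hw.measurable_sum L).ennreal_ofReal
  set a : ℝ := ∑ l ∈ Finset.Icc 1 L, P.real {ξ | S.requestPhase (fun c => X c ξ) v l <
      S.depletionTime fun c => X c ξ} with ha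
  have ha0 : 0 ≤ a := Finset.sum_nonneg fun _ _ => measureReal_nonneg
  have hω : 0 ≤ S.ω := S.ω_pos.le
  have hsum : ENNReal.ofReal a = ENNReal.ofReal S.ω * ∫⁻ ξ,
      ENNReal.ofReal (∫ t in (0 : ℝ)..(∑ i ∈ Finset.range L, X (.request v i) ξ), φ t) ∂P := by
    have h1 := hw.sum_lintegral (f := fun t => ENNReal.ofReal (φ t)) hφm.ennreal_ofReal L
    rw [ha, ENNReal.ofReal_sum_of_nonneg fun _ _ => measureReal_nonneg]
    rw [Finset.sum_congr rfl fun l _ =>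
      (ofReal_measureReal (μ := P)).trans (hX.measure_requestPhase_lt mX v l)]
    rw [← Finset.sum_image (s := Finset.range L) (g := fun l => l + 1) (by simp)
      (f := fun l => ∫⁻ ξ, ENNReal.ofReal (φ (∑ i ∈ Finset.range l, X (.request v i) ξ)) ∂P)] at h1
    have h2 : (Finset.range L).image (fun l => l + 1) = Finset.Icc 1 L := by
      ext l
      simp only [Finset.mem_image, Finset.mem_range, Finset.mem_Icc]
      exact ⟨by rintro ⟨m, hm, rfl⟩; omega, fun h => ⟨l - 1, by omega, by omega⟩⟩
    rw [h2] at h1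
    rw [h1]
    congr 1
    refine lintegral_congr_ae ?_
    filter_upwards [hW0] with ξ hξ using hI _ hξ
  have hL : ENNReal.ofReal (L * S.d2dProb) = ENNReal.ofReal S.ω * ∫⁻ ξ,
      ENNReal.ofReal ((∑ i ∈ Finset.range L, X (.request v i) ξ) * S.d2dProb) ∂P := by
    have h1 := hw.lintegral_sum L
    simp_rw [ENNReal.ofReal_mul' hd0]
    rw [lintegral_mul_const _ hmW, ← mul_assoc, h1, ENNReal.ofReal_natCast]
  have hdev : ∀ T, |(∫ t in (0 : ℝ)..T, φ t) - T * S.d2dProb| ≤ S.Δ := by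
    intro T
    rw [← hd]
    exact abs_integral_sub_mean_le S.Δ_pos hφp hφm hφ0 hφ1 T
  -- A pointwise bound by `Δ` passes through the expectation. It is used once in each direction, as
  -- `ℝ≥0∞` has no signed differences.
  have hle : ∀ f g : Ω → ℝ, (∀ ξ, f ξ ≤ g ξ + S.Δ) →
      ENNReal.ofReal S.ω * ∫⁻ ξ, ENNReal.ofReal (f ξ) ∂P ≤
        ENNReal.ofReal S.ω * ∫⁻ ξ, ENNReal.ofReal (g ξ) ∂P + ENNReal.ofReal (S.ω * S.Δ) := by
    intro f g hfg
    rw [ENNReal.ofReal_mul hω, ← mul_add]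
    gcongr
    calc _ ≤ ∫⁻ ξ, (ENNReal.ofReal (g ξ) + ENNReal.ofReal S.Δ) ∂P :=
          lintegral_mono fun ξ => (ENNReal.ofReal_le_ofReal (hfg ξ)).trans ENNReal.ofReal_add_le
      _ = _ := by rw [lintegral_add_right _ measurable_const]; simp
  have hc : 0 ≤ S.ω * S.Δ := mul_nonneg hω S.Δ_pos.le
  have hLd : 0 ≤ L * S.d2dProb := mul_nonneg (Nat.cast_nonneg _) hd0
  rw [abs_le]
  constructor
  · have := hle (fun ξ => (∑ i ∈ Finset.range L, X (.request v i) ξ) * S.d2dProb)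
      (fun ξ => ∫ t in (0 : ℝ)..(∑ i ∈ Finset.range L, X (.request v i) ξ), φ t)
      fun ξ => by linarith [(abs_le.1 (hdev (∑ i ∈ Finset.range L, X (.request v i) ξ))).1]
    rw [← hL, ← hsum, ← ENNReal.ofReal_add ha0 hc, ENNReal.ofReal_le_ofReal_iff (by positivity)]
      at this
    linarith
  · have := hle (fun ξ => ∫ t in (0 : ℝ)..(∑ i ∈ Finset.range L, X (.request v i) ξ), φ t)
      (fun ξ => (∑ i ∈ Finset.range L, X (.request v i) ξ) * S.d2dProb)
      fun ξ => by linarith [(abs_le.1 (hdev (∑ i ∈ Finset.range L, X (.request v i) ξ))).2]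
    rw [← hL, ← hsum, ← ENNReal.ofReal_add hLd hc, ENNReal.ofReal_le_ofReal_iff (by positivity)]
      at this
    linarith

theorem hasD2DProb : S.HasD2DProb P X S.d2dProb := by
  intro v
  refine tendsto_iff_norm_sub_tendsto_zero.2 ?_
  refine squeeze_zero' (Eventually.of_forall fun _ => norm_nonneg _) ?_
    (tendsto_const_div_atTop_nhds_zero_nat (S.ω * S.Δ))
  filter_upwards [eventually_gt_atTop 0] with L hL
  have hL' : (0 : ℝ) < L := by exact_mod_cast hL
  have h := hX.abs_sum_measureReal_requestPhase_lt mX v L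
  rw [Real.norm_eq_abs, le_div_iff₀ hL']
  refine le_of_eq_of_le ?_ h
  rw [← abs_of_pos hL', ← abs_mul, abs_of_pos hL']
  congr 1
  field_simp

theorem hasBSProb : S.HasBSProb P X (1 - S.d2dProb) := by
  intro v
  refine (tendsto_const_nhds.sub (hX.hasD2DProb mX v)).congr' ?_
  filter_upwards [eventually_gt_atTop 0] with L hL
  have hL' : (L : ℝ) ≠ 0 := by exact_mod_cast hL.ne'
  have h1 : ∀ l, P.real {ξ | S.depletionTime (fun c => X c ξ) ≤
      S.requestPhase (fun c => X c ξ) v l} = 1 - P.real {ξ | S.requestPhase (fun c => X c ξ) v l <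
      S.depletionTime fun c => X c ξ} := by
    intro l
    rw [← probReal_compl_eq_one_sub (measurableSet_requestPhase_lt mX v l)]
    congr 1
    ext ξ
    simp
  simp_rw [h1]
  rw [Finset.sum_sub_distrib, mul_sub]
  simp [hL']

end IsModel

end DSNetwork

/-! ### The stationary queue of nodes and the expected cost. -/

/-- The weights satisfy `(k + 1) p_{k+1} = r p_k`, and the `p_k` sum to `1`. -/
theorem lintegral_natCast_poissonMeasure (r : NNReal) :
    ∫⁻ k, (k : ℝ≥0∞) ∂poissonMeasure r = r := by
  have h1 : ∀ k : ℕ, ((k + 1 : ℕ) : ℝ≥0∞) * poissonMeasure r {k + 1} =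
      r * poissonMeasure r {k} := by
    intro k
    rw [poissonMeasure_singleton, poissonMeasure_singleton, ← ENNReal.ofReal_natCast (k + 1),
      ← ENNReal.ofReal_coe_nnreal (p := r), ← ENNReal.ofReal_mul (by positivity),
      ← ENNReal.ofReal_mul (by positivity)]
    congr 1
    rw [Nat.factorial_succ]
    push_cast
    field_simp
    ring
  rw [lintegral_countable', tsum_eq_zero_add' ENNReal.summable, Nat.cast_zero, zero_mul, zero_add]
  simp_rw [h1]
  rw [ENNReal.tsum_mul_left]
  have h2 := lintegral_countable' (μ := poissonMeasure r) (fun _ => 1)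
  simp only [one_mul, lintegral_const, measure_univ] at h2
  rw [← h2, mul_one]

theorem tsum_measure_lt_natCast {Ω : Type*} [MeasurableSpace Ω] {P : Measure Ω} {K : Ω → ℕ}
    (hK : Measurable K) : ∑' j, P {ξ | j < K ξ} = ∫⁻ ξ, (K ξ : ℝ≥0∞) ∂P := by
  have hm : ∀ j, MeasurableSet {ξ | j < K ξ} := fun j => measurableSet_lt measurable_const hK
  have h1 : ∀ ξ, (K ξ : ℝ≥0∞) = ∑' j, {ξ | j < K ξ}.indicator 1 ξ := by
    intro ξ
    rw [tsum_eq_sum (s := Finset.range (K ξ)) fun j hj =>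
      Set.indicator_of_notMem (by simpa using hj) _]
    rw [Finset.sum_congr rfl fun j hj => Set.indicator_of_mem
      (show ξ ∈ {ξ | j < K ξ} by simpa using hj) (1 : Ω → ℝ≥0∞)]
    simp
  simp_rw [h1]
  rw [lintegral_tsum fun j => (measurable_one.indicator (hm j)).aemeasurable]
  simp_rw [lintegral_indicator_one (hm _)]

/-- In the stationary `M/M/∞` queue, the nodes present initially and those that have arrived
since have a constant total intensity. -/
theorem lintegral_stationary {r : ℝ} (hr : 0 < r) {f : ℝ → ℝ≥0∞} (hf : Measurable f) :
    (∫⁻ s in Set.Ioi 0, f s * ENNReal.ofReal (Real.exp (-(r * s)))) +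
      ∫⁻ a in Set.Ioi 0, (∫⁻ t, f (a + t) ∂expMeasure r) = ∫⁻ s in Set.Ioi 0, f s := by
  have := isProbabilityMeasure_expMeasure hr
  have h1 : ∫⁻ a in Set.Ioi (0 : ℝ), (∫⁻ t, f (a + t) ∂expMeasure r) =
      ∫⁻ s in Set.Ioi 0, f s * expMeasure r (Set.Iio s) := by
    have hfm : Measurable (Function.uncurry fun a t => f (a + t)) :=
      hf.comp (measurable_fst.add measurable_snd)
    rw [lintegral_lintegral_swap hfm.aemeasurable]
    have h2 : ∀ t > 0, ∫⁻ a in Set.Ioi (0 : ℝ), f (a + t) =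
        ∫⁻ s in Set.Ioi 0, (Set.Iio s).indicator (fun _ => f s) t := by
      intro t ht
      rw [← lintegral_indicator measurableSet_Ioi, ← lintegral_indicator measurableSet_Ioi]
      conv_rhs => rw [← lintegral_add_right_eq_self _ t]
      refine lintegral_congr fun a => ?_
      by_cases ha : 0 < a
      · have : 0 < a + t := by linarith
        simp [ha, this]
      · simp [ha, Set.indicator]
    have h3 : ∫⁻ t, (∫⁻ a in Set.Ioi (0 : ℝ), f (a + t)) ∂expMeasure r =
        ∫⁻ t, (∫⁻ s in Set.Ioi 0, (Set.Iio s).indicator (fun _ => f s) t) ∂expMeasure r := by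
      refine lintegral_congr_ae ?_
      filter_upwards [ae_expMeasure_pos hr] with t ht using h2 t ht
    rw [h3, lintegral_lintegral_swap]
    · refine lintegral_congr fun s => ?_
      rw [lintegral_indicator measurableSet_Iio, setLIntegral_const]
    · refine Measurable.aemeasurable ?_
      have : (Function.uncurry fun t s => (Set.Iio s).indicator (fun _ => f s) t) =
          {q : ℝ × ℝ | q.1 < q.2}.indicator fun q => f q.2 := by
        ext q; simp [Set.indicator, Function.uncurry]
      rw [this]
      exact (hf.comp measurable_snd).indicator (measurableSet_lt measurable_fst measurable_snd)
  have hfE : Measurable fun s => f s * ENNReal.ofReal (Real.exp (-(r * s))) :=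
    hf.mul (by fun_prop)
  rw [h1, ← lintegral_add_left hfE]
  -- At time `s` the initial nodes carry weight `exp (-(r * s))`, the probability of `[s, ∞)`, and
  -- the later arrivals carry that of `(-∞, s)`.
  refine setLIntegral_congr_fun measurableSet_Ioi fun s hs => ?_
  rw [← expMeasure_Ici hr (le_of_lt hs), ← mul_add, add_comm, ← Set.compl_Iio,
    measure_add_measure_compl measurableSet_Iio, measure_univ, mul_one]

/-- The two kinds of nodes. -/
def cellNodeEquiv : ℕ ⊕ ℕ ≃ CellNode where
  toFun := Sum.elim .initial .arriving
  invFun v := match v with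
    | .initial j => .inl j
    | .arriving j => .inr j
  left_inv := by rintro (j | j) <;> rfl
  right_inv := by rintro (j | j) <;> rfl

theorem tsum_cellNode (g : CellNode → ℝ≥0∞) :
    ∑' v, g v = ∑' j, g (.initial j) + ∑' j, g (.arriving j) := by
  rw [← cellNodeEquiv.tsum_eq,
    Summable.tsum_sum (f := fun v => g (cellNodeEquiv v)) ENNReal.summable ENNReal.summable]
  rfl

namespace DSNetwork

variable {S : DSNetwork} {Ω : Type*} [MeasurableSpace Ω] {P : Measure Ω} [IsProbabilityMeasure P]
  {X : Clock S.n → Ω → ℝ} {K : Ω → ℕ}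

/-- Mean cost of a download requested at time `s` after a repair. -/
noncomputable def meanCost (S : DSNetwork) (s : ℝ) : ℝ :=
  S.ρD2D * (S.h * S.α) * S.survival s + S.ρBS * S.M * (1 - S.survival s)

theorem continuous_meanCost (S : DSNetwork) : Continuous S.meanCost :=
  (continuous_const.mul S.continuous_survival).add
    (continuous_const.mul (continuous_const.sub S.continuous_survival))

/-- Mean cost of a download requested at time `t`, if that is in the `q`-th repair interval. -/
noncomputable def intervalMeanCost (S : DSNetwork) (q : ℕ) : ℝ → ℝ≥0∞ :=
  (Set.Ico (q * S.Δ) ((q + 1) * S.Δ)).indicator fun t => ENNReal.ofReal (S.meanCost (t - q * S.Δ))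

theorem measurable_intervalMeanCost (S : DSNetwork) (q : ℕ) : Measurable (S.intervalMeanCost q) :=
  (S.continuous_meanCost.measurable.comp (measurable_id.sub_const _)).ennreal_ofReal.indicator
    measurableSet_Ico

open Classical in
/-- Cost of the `l`-th request of node `v` if that is made in the `q`-th repair interval. -/
noncomputable def nodeCost (S : DSNetwork) (q : ℕ) (v : CellNode) (l : ℕ) (x : Clock S.n → ℝ) :
    ℝ≥0∞ :=
  if S.requestClock x v (l + 1) < x (.lifetime v) ∧
    S.arrivalTime x v + S.requestClock x v (l + 1) ∈ Set.Ico (q * S.Δ) ((q + 1) * S.Δ)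
  then ENNReal.ofReal (S.requestCost x (S.arrivalTime x v + S.requestClock x v (l + 1))) else 0

theorem measurable_nodeCost (S : DSNetwork) (q : ℕ) (v : CellNode) (l : ℕ) :
    Measurable (S.nodeCost q v l) := by
  classical
  have h1 := (S.measurable_arrivalTime v).add (S.measurable_requestClock v (l + 1))
  refine Measurable.ite ((measurableSet_lt (S.measurable_requestClock v _)
    (measurable_pi_apply _)).inter (h1 measurableSet_Ico)) ?_ measurable_const
  exact (S.measurable_requestCost.comp (measurable_id.prodMk h1)).ennreal_ofReal

namespace IsModel

variable (hX : S.IsModel P X K) (mX : ∀ c, Measurable (X c))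

include hX mX

theorem meanCost_nonneg {s : ℝ} (hs : 0 ≤ s) : 0 ≤ S.meanCost s :=
  add_nonneg
    (mul_nonneg (mul_nonneg S.ρD2D_nonneg (mul_nonneg (Nat.cast_nonneg _) S.α_pos.le))
      (hX.survival_nonneg mX hs))
    (mul_nonneg (mul_nonneg S.ρBS_nonneg S.M_pos.le)
      (sub_nonneg.2 (hX.survival_le_one mX hs)))

theorem lintegral_requestCost (q : ℕ) {s : ℝ} (hs : 0 ≤ s) (hs' : s < S.Δ) :
    ∫⁻ ξ, ENNReal.ofReal (S.requestCost (fun c => X c ξ) (q * S.Δ + s)) ∂P =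
      ENNReal.ofReal (S.meanCost s) := by
  set E := {ξ | S.h ≤ S.storageCount (fun c => X c ξ) (q * S.Δ + s)} with hE
  have hEm : MeasurableSet E :=
    (S.measurable_storageCount.comp ((measurable_pi_lambda _ mX).prodMk measurable_const))
      (measurableSet_Ici (a := S.h))
  have hPE : P.real E = S.survival s := hX.measureReal_le_storageCount mX q hs hs'
  have hPE' : P.real Eᶜ = 1 - S.survival s := by rw [probReal_compl_eq_one_sub hEm, hPE]
  have h1 : ∀ ξ, ENNReal.ofReal (S.requestCost (fun c => X c ξ) (q * S.Δ + s)) =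
      E.indicator (fun _ => ENNReal.ofReal (S.ρD2D * (S.h * S.α))) ξ +
        Eᶜ.indicator (fun _ => ENNReal.ofReal (S.ρBS * S.M)) ξ := by
    intro ξ
    by_cases h : S.h ≤ S.storageCount (fun c => X c ξ) (q * S.Δ + s)
    · have : ξ ∈ E := h
      simp [requestCost, h, this]
    · have : ξ ∉ E := h
      simp [requestCost, h, this]
  have h0 := hX.survival_nonneg mX hs
  have h2 := sub_nonneg.2 (hX.survival_le_one mX hs)
  have hD : 0 ≤ S.ρD2D * (S.h * S.α) :=
    mul_nonneg S.ρD2D_nonneg (mul_nonneg (Nat.cast_nonneg _) S.α_pos.le)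
  have hB : 0 ≤ S.ρBS * S.M := mul_nonneg S.ρBS_nonneg S.M_pos.le
  simp_rw [h1]
  rw [lintegral_add_left (measurable_const.indicator hEm), lintegral_indicator hEm,
    lintegral_indicator hEm.compl, setLIntegral_const, setLIntegral_const, ← ofReal_measureReal,
    ← ofReal_measureReal (s := Eᶜ), hPE, hPE', ← ENNReal.ofReal_mul hD, ← ENNReal.ofReal_mul hB,
    ← ENNReal.ofReal_add (mul_nonneg hD h0) (mul_nonneg hB h2)]
  rfl

/-- Storage averages to the mean cost at the request time, the lifetime to its tail there. Arrival
and request clocks are left as independent variables, ready for the two renewal measures. -/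
theorem lintegral_nodeCost (q : ℕ) (v : CellNode) (l : ℕ) :
    ∫⁻ ξ, S.nodeCost q v l (fun c => X c ξ) ∂P =
      ∫⁻ ξ, ∫⁻ ξ', S.intervalMeanCost q (S.arrivalTime (fun c => X c ξ) v +
        S.requestClock (fun c => X c ξ') v (l + 1)) * ENNReal.ofReal
          (Real.exp (-(S.μ * S.requestClock (fun c => X c ξ') v (l + 1)))) ∂P ∂P := by
  classical
  have hA := S.measurable_arrivalTime v
  have hW := S.measurable_requestClock v (l + 1)
  have hm : Measurable fun ξ c => X c ξ := measurable_pi_lambda _ mX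
  have hf := S.measurable_intervalMeanCost q
  have arrival_congr : ∀ x y : Clock S.n → ℝ, (∀ j, x (.interarrival j) = y (.interarrival j)) →
      S.arrivalTime x v = S.arrivalTime y v := by
    intro x y h
    cases v <;> simp only [arrivalTime, h]
  have request_congr : ∀ x y : Clock S.n → ℝ, (∀ l, x (.request v l) = y (.request v l)) →
      S.requestClock x v (l + 1) = S.requestClock y v (l + 1) := by
    intro x y h
    simp only [requestClock, h]
  -- the storage clocks
  have integrate_storage : ∫⁻ ξ, S.nodeCost q v l (fun c => X c ξ) ∂P =
      ∫⁻ ξ, (if S.requestClock (fun c => X c ξ) v (l + 1) < X (.lifetime v) ξ then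
        S.intervalMeanCost q (S.arrivalTime (fun c => X c ξ) v +
          S.requestClock (fun c => X c ξ) v (l + 1)) else 0) ∂P := by
    have h := hX.lintegral_storage mX
      (U := fun x => ((S.arrivalTime x v, S.requestClock x v (l + 1)), x (.lifetime v)))
      ((hA.prodMk hW).prodMk (measurable_pi_apply _))
      (F := fun u y => if u.1.2 < u.2 ∧ u.1.1 + u.1.2 ∈ Set.Ico (q * S.Δ) ((q + 1) * S.Δ)
        then ENNReal.ofReal (S.requestCost y (u.1.1 + u.1.2)) else 0) ?_ ?_ ?_
    · refine h.trans (lintegral_congr fun ξ => ?_)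
      dsimp only
      by_cases h1 : S.requestClock (fun c => X c ξ) v (l + 1) < X (.lifetime v) ξ
      · by_cases h2 : S.arrivalTime (fun c => X c ξ) v + S.requestClock (fun c => X c ξ) v (l + 1) ∈
          Set.Ico (q * S.Δ) ((q + 1) * S.Δ)
        · simp only [h1, h2, and_self, if_true, intervalMeanCost, Set.indicator_of_mem]
          rw [← hX.lintegral_requestCost mX q (sub_nonneg.2 h2.1) (by linarith [h2.2])]
          simp only [add_sub_cancel]
        · simp only [h1, h2, and_false, if_true, if_false, lintegral_zero, intervalMeanCost]
          rw [Set.indicator_of_notMem h2]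
      · simp [h1]
    · have ms : Measurable fun p : ((ℝ × ℝ) × ℝ) × (Clock S.n → ℝ) => p.1.1.1 + p.1.1.2 :=
        measurable_fst.fst.fst.add measurable_fst.fst.snd
      refine Measurable.ite ((measurableSet_lt measurable_fst.fst.snd measurable_fst.snd).inter
        (ms measurableSet_Ico)) ?_ measurable_const
      exact (S.measurable_requestCost.comp (measurable_snd.prodMk ms)).ennreal_ofReal
    · intro x y hxy
      rw [arrival_congr x y fun j => hxy _ (by simp), request_congr x y fun j => hxy _ (by simp),
        hxy (.lifetime v) (by simp)]
    · intro b x y hxy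
      simp only [requestCost, S.storageCount_congr hxy]
  -- the lifetime of the node
  have integrate_lifetime : ∫⁻ ξ, (if S.requestClock (fun c => X c ξ) v (l + 1) < X (.lifetime v) ξ then
        S.intervalMeanCost q (S.arrivalTime (fun c => X c ξ) v +
          S.requestClock (fun c => X c ξ) v (l + 1)) else 0) ∂P =
      ∫⁻ ξ, S.intervalMeanCost q (S.arrivalTime (fun c => X c ξ) v +
        S.requestClock (fun c => X c ξ) v (l + 1)) * ENNReal.ofReal
          (Real.exp (-(S.μ * S.requestClock (fun c => X c ξ) v (l + 1)))) ∂P := by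
    have hind : IndepFun (fun ξ => (S.arrivalTime (fun c => X c ξ) v,
        S.requestClock (fun c => X c ξ) v (l + 1))) (fun ξ => X (.lifetime v) ξ) P := by
      refine hX.indepFun_clocks_of_disjoint mX (s := {.lifetime v}ᶜ) (t := {.lifetime v})
        disjoint_compl_left (hA.prodMk hW) (G := fun x => x (.lifetime v)) (measurable_pi_apply _)
        (fun x => ?_) fun x => Set.indicator_of_mem (Set.mem_singleton _) x
      have h1 : ∀ c, c ≠ .lifetime v → ({.lifetime v}ᶜ : Set (Clock S.n)).indicator x c = x c :=
        fun c hc => Set.indicator_of_mem hc x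
      rw [arrival_congr _ x fun j => h1 _ (by simp), request_congr _ x fun j => h1 _ (by simp)]
    have h := lintegral_of_indepFun ((hA.prodMk hW).comp hm) (mX (.lifetime v)) hind
      (F := fun u t => if u.2 < t then S.intervalMeanCost q (u.1 + u.2) else 0)
      (Measurable.ite (measurableSet_lt measurable_fst.snd measurable_snd)
        (hf.comp (measurable_fst.fst.add measurable_fst.snd)) measurable_const)
    refine h.trans (lintegral_congr_ae ?_)
    filter_upwards [hX.ae_pos mX] with ξ hξ
    have hW0 : 0 ≤ S.requestClock (fun c => X c ξ) v (l + 1) :=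
      Finset.sum_nonneg fun i _ => (hξ _).le
    rw [← measure_lt_of_map_eq_expMeasure (mX (.lifetime v)) S.μ_pos
      (hX.hasLaw_clock (.lifetime v)).map_eq hW0, ← lintegral_indicator_const
      (measurableSet_lt measurable_const (mX _))]
    refine lintegral_congr fun ξ' => ?_
    by_cases hlt : S.requestClock (fun c => X c ξ) v (l + 1) < X (.lifetime v) ξ'
    · exact (if_pos hlt).trans (Set.indicator_of_mem (s := {ξ' | _ < X _ ξ'}) hlt fun _ =>
        S.intervalMeanCost q (S.arrivalTime (fun c => X c ξ) v +
          S.requestClock (fun c => X c ξ) v (l + 1))).symm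
    · exact (if_neg hlt).trans (Set.indicator_of_notMem (s := {ξ' | _ < X _ ξ'}) hlt fun _ =>
        S.intervalMeanCost q (S.arrivalTime (fun c => X c ξ) v +
          S.requestClock (fun c => X c ξ) v (l + 1))).symm
  -- arrivals and requests
  rw [integrate_storage, integrate_lifetime]
  have hind : IndepFun (fun ξ => S.arrivalTime (fun c => X c ξ) v)
      (fun ξ => S.requestClock (fun c => X c ξ) v (l + 1)) P := by
    let s : Set (Clock S.n) := {c | ∃ j, c = .interarrival j}
    refine hX.indepFun_clocks_of_disjoint mX (s := s) (t := sᶜ) disjoint_compl_right hA hW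
      (fun x => ?_) fun x => ?_
    · exact arrival_congr _ _ fun j => Set.indicator_of_mem (s := s) ⟨j, rfl⟩ x
    · exact request_congr _ _ fun j => Set.indicator_of_mem (s := sᶜ) (by simp [s]) x
  exact lintegral_of_indepFun (hA.comp hm) (hW.comp hm) hind
    (F := fun a w => S.intervalMeanCost q (a + w) * ENNReal.ofReal (Real.exp (-(S.μ * w))))
    ((hf.comp (measurable_fst.add measurable_snd)).mul (by fun_prop))

/-- Mean cost of the requests, in the `q`-th repair interval, of a node in the cell from time `a`. -/
noncomputable def _root_.DSNetwork.arrivalMeanCost (S : DSNetwork) (q : ℕ) (a : ℝ) : ℝ≥0∞ :=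
  ENNReal.ofReal S.ω * ∫⁻ t in Set.Ioi 0,
    S.intervalMeanCost q (a + t) * ENNReal.ofReal (Real.exp (-(S.μ * t)))

omit hX mX [IsProbabilityMeasure P] in
-- Nodes arrive at rate `N * μ`; the factor `μ` completes the survival weight to the exponential
-- density, the form required by `lintegral_stationary`.
theorem mul_arrivalMeanCost (q : ℕ) (a : ℝ) :
    ENNReal.ofReal S.μ * S.arrivalMeanCost q a =
      ENNReal.ofReal S.ω * ∫⁻ t, S.intervalMeanCost q (a + t) ∂expMeasure S.μ := by
  have hf : Measurable fun t => S.intervalMeanCost q (a + t) :=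
    (S.measurable_intervalMeanCost q).comp (measurable_const_add a)
  rw [lintegral_expMeasure S.μ hf,
    arrivalMeanCost, mul_left_comm, ← lintegral_const_mul' _ _ ENNReal.ofReal_ne_top]
  congr 1
  refine lintegral_congr fun t => ?_
  rw [ENNReal.ofReal_mul S.μ_pos.le]
  ring

omit hX mX [IsProbabilityMeasure P] in
theorem measurable_arrivalMeanCost (q : ℕ) : Measurable (S.arrivalMeanCost q) := by
  have hE : Measurable fun t => ENNReal.ofReal (Real.exp (-(S.μ * t))) := by fun_prop
  refine Measurable.const_mul ?_ _
  exact (((S.measurable_intervalMeanCost q).comp (measurable_fst.add measurable_snd)).mul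
    (hE.comp measurable_snd)).lintegral_prod_right'

theorem tsum_lintegral_nodeCost (q : ℕ) (v : CellNode) :
    ∑' l, ∫⁻ ξ, S.nodeCost q v l (fun c => X c ξ) ∂P =
      ∫⁻ ξ, S.arrivalMeanCost q (S.arrivalTime (fun c => X c ξ) v) ∂P := by
  have hm : Measurable fun ξ c => X c ξ := measurable_pi_lambda _ mX
  have hf := S.measurable_intervalMeanCost q
  have hw : IsExpWalk P S.ω fun i => X (.request v i) :=
    hX.isExpWalk mX (k := fun i => .request v i) (fun a b h => by simpa using h) fun _ => rfl
  simp_rw [hX.lintegral_nodeCost mX]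
  rw [← lintegral_tsum]
  · refine lintegral_congr fun ξ => ?_
    exact hw.tsum_lintegral (f := fun t => S.intervalMeanCost q (S.arrivalTime (fun c => X c ξ) v +
      t) * ENNReal.ofReal (Real.exp (-(S.μ * t))))
      ((hf.comp (measurable_const_add _)).mul (by fun_prop))
  · intro l
    refine Measurable.aemeasurable ?_
    have h1 : Measurable fun p : Ω × Ω => S.arrivalTime (fun c => X c p.1) v :=
      ((S.measurable_arrivalTime v).comp hm).comp measurable_fst
    have h2 : Measurable fun p : Ω × Ω => S.requestClock (fun c => X c p.2) v (l + 1) :=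
      ((S.measurable_requestClock v _).comp hm).comp measurable_snd
    have hE : Measurable fun t => ENNReal.ofReal (Real.exp (-(S.μ * t))) := by fun_prop
    exact ((hf.comp (h1.add h2)).mul (hE.comp h2)).lintegral_prod_right'

theorem expectedIntervalCost_eq_tsum (mK : Measurable K) (q : ℕ) :
    S.expectedIntervalCost P X K q = ∑' v, P {ξ | IsPresent (K ξ) v} *
      ∫⁻ ξ, S.arrivalMeanCost q (S.arrivalTime (fun c => X c ξ) v) ∂P := by
  classical
  have hm : Measurable fun ξ c => X c ξ := measurable_pi_lambda _ mX
  have hpres : ∀ v, MeasurableSet {k : ℕ | IsPresent k v} := fun v => .of_discrete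
  have h1 : ∀ ξ, S.intervalCost (fun c => X c ξ) (K ξ) q = ∑' (v : CellNode) (l : ℕ),
      {k | IsPresent k v}.indicator 1 (K ξ) * S.nodeCost q v l fun c => X c ξ := by
    intro ξ
    refine tsum_congr fun v => tsum_congr fun l => ?_
    by_cases h : IsPresent (K ξ) v
    · simp [h, nodeCost]
    · simp [h]
  have hmt : ∀ v l, Measurable fun ξ =>
      {k | IsPresent k v}.indicator (1 : ℕ → ℝ≥0∞) (K ξ) * S.nodeCost q v l fun c => X c ξ :=
    fun v l => ((measurable_one.indicator (hpres v)).comp mK).mul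
      ((S.measurable_nodeCost q v l).comp hm)
  rw [expectedIntervalCost]
  simp_rw [h1]
  rw [lintegral_tsum fun v => (Measurable.tsum fun l => hmt v l).aemeasurable]
  refine tsum_congr fun v => ?_
  rw [lintegral_tsum fun l => (hmt v l).aemeasurable, ← hX.tsum_lintegral_nodeCost mX,
    ← ENNReal.tsum_mul_left]
  refine tsum_congr fun l => ?_
  rw [lintegral_of_indepFun mK hm hX.indepFun_initial
    (F := fun k x => {k | IsPresent k v}.indicator (1 : ℕ → ℝ≥0∞) k * S.nodeCost q v l x)
    (((measurable_one.indicator (hpres v)).comp measurable_fst).mul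
      ((S.measurable_nodeCost q v l).comp measurable_snd))]
  refine (lintegral_congr fun ξ =>
    lintegral_const_mul _ ((S.measurable_nodeCost q v l).comp hm)).trans ?_
  have hI : Measurable fun ξ => {k | IsPresent k v}.indicator (1 : ℕ → ℝ≥0∞) (K ξ) :=
    (measurable_one.indicator (hpres v)).comp mK
  rw [lintegral_mul_const _ hI]
  congr 1
  exact lintegral_indicator_one (mK (hpres v))

/-- Initial nodes number `N` on average and start at time `0`; the arrival times have renewal
measure `N μ da`. `lintegral_stationary` adds the two contributions. -/
theorem expectedIntervalCost_eq (mK : Measurable K) (q : ℕ) :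
    S.expectedIntervalCost P X K q =
      ENNReal.ofReal (S.N * S.ω) * ∫⁻ t in Set.Ioi 0, S.intervalMeanCost q t := by
  have hN : ∑' j, P {ξ | j < K ξ} = ENNReal.ofReal S.N := by
    have h := lintegral_natCast_poissonMeasure S.N.toNNReal
    rw [← hX.hasLaw_initial.map_eq, lintegral_map .of_discrete mK] at h
    exact (tsum_measure_lt_natCast mK).trans h
  have hw : IsExpWalk P (S.N * S.μ) fun i => X (.interarrival i) :=
    hX.isExpWalk mX (k := fun i => .interarrival i) (fun a b h => by simpa using h) fun _ => rfl
  have hf := S.measurable_intervalMeanCost q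
  rw [hX.expectedIntervalCost_eq_tsum mX mK, tsum_cellNode]
  simp only [IsPresent, arrivalTime, lintegral_const, measure_univ, mul_one, Set.ofPred_true,
    one_mul]
  rw [ENNReal.tsum_mul_right, hN, hw.tsum_lintegral (measurable_arrivalMeanCost q),
    ENNReal.ofReal_mul S.N_pos.le, mul_assoc, ← lintegral_const_mul' _ _ ENNReal.ofReal_ne_top]
  simp_rw [mul_arrivalMeanCost]
  rw [lintegral_const_mul' _ _ ENNReal.ofReal_ne_top, arrivalMeanCost, ← mul_add, ← mul_add,
    ENNReal.ofReal_mul S.N_pos.le, mul_assoc]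
  simp only [zero_add]
  rw [lintegral_stationary S.μ_pos hf]

omit hX mX [IsProbabilityMeasure P] in
theorem integral_meanCost : ∫ s in (0 : ℝ)..S.Δ, S.meanCost s =
    S.Δ * (S.ρBS * S.M * (1 - S.d2dProb) + S.ρD2D * (S.h * S.α) * S.d2dProb) := by
  have hJ : ∫ s in (0 : ℝ)..S.Δ, S.survival s = S.Δ * S.d2dProb := by
    rw [d2dProb]
    field_simp [S.Δ_pos.ne']
  have hi := S.continuous_survival.intervalIntegrable (μ := volume) 0 S.Δ
  unfold meanCost
  rw [intervalIntegral.integral_add (hi.const_mul _)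
      ((intervalIntegrable_const.sub hi).const_mul _), intervalIntegral.integral_const_mul,
    intervalIntegral.integral_const_mul, intervalIntegral.integral_sub intervalIntegrable_const hi,
    hJ]
  simp
  ring

theorem lintegral_intervalMeanCost (q : ℕ) :
    ∫⁻ t in Set.Ioi 0, S.intervalMeanCost q t =
      ENNReal.ofReal (∫ s in (0 : ℝ)..S.Δ, S.meanCost s) := by
  have hq : 0 ≤ q * S.Δ := mul_nonneg (Nat.cast_nonneg _) S.Δ_pos.le
  have h1 : ∫⁻ t in Set.Ioi 0, S.intervalMeanCost q t =
      ∫⁻ t, (Set.Ioc 0 S.Δ).indicator (fun s => ENNReal.ofReal (S.meanCost s)) t := by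
    rw [← lintegral_indicator measurableSet_Ioi, ← lintegral_add_right_eq_self _ (q * S.Δ)]
    refine lintegral_congr_ae ?_
    -- The repair interval contains its left endpoint and `Set.Ioc` its right one; both are null.
    filter_upwards [Measure.ae_ne volume (0 : ℝ), Measure.ae_ne volume S.Δ] with t h0 hΔ
    have e : (q + 1) * S.Δ = q * S.Δ + S.Δ := by ring
    by_cases ht : t ∈ Set.Ioc 0 S.Δ
    · have h2 : t + q * S.Δ ∈ Set.Ioi 0 := by have := ht.1; simp only [Set.mem_Ioi]; linarith
      have h3 : t + q * S.Δ ∈ Set.Ico (q * S.Δ) ((q + 1) * S.Δ) := by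
        have h4 := lt_of_le_of_ne ht.2 hΔ
        have := ht.1
        constructor <;> linarith
      rw [Set.indicator_of_mem h2, Set.indicator_of_mem ht, intervalMeanCost,
        Set.indicator_of_mem h3, add_sub_cancel_right]
    · rw [Set.indicator_of_notMem ht]
      have h3 : t + q * S.Δ ∉ Set.Ico (q * S.Δ) ((q + 1) * S.Δ) := by
        rintro ⟨h3, h4⟩
        exact ht ⟨lt_of_le_of_ne (by linarith) (Ne.symm h0), by linarith⟩
      by_cases h2 : t + q * S.Δ ∈ Set.Ioi 0
      · rw [Set.indicator_of_mem h2, intervalMeanCost, Set.indicator_of_notMem h3]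
      · rw [Set.indicator_of_notMem h2]
  rw [h1, lintegral_indicator measurableSet_Ioc, intervalIntegral.integral_of_le S.Δ_pos.le,
    ofReal_integral_eq_lintegral_ofReal]
  · exact (S.continuous_meanCost.integrableOn_Icc (a := 0) (b := S.Δ)).mono_set Set.Ioc_subset_Icc_self
  · filter_upwards [ae_restrict_mem measurableSet_Ioc] with t ht
      using hX.meanCost_nonneg mX ht.1.le

theorem hasAvgDownloadCost (mK : Measurable K) : S.HasAvgDownloadCost P X K
    (S.N * S.ω / S.M * (S.ρBS * S.M * (1 - S.d2dProb) + S.ρD2D * (S.h * S.α) * S.d2dProb)) := by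
  intro q
  have hNω : 0 ≤ S.N * S.ω := mul_nonneg S.N_pos.le S.ω_pos.le
  have h0 : 0 ≤ ∫ s in (0 : ℝ)..S.Δ, S.meanCost s :=
    intervalIntegral.integral_nonneg S.Δ_pos.le fun t ht => hX.meanCost_nonneg mX ht.1
  have h := hX.expectedIntervalCost_eq mX mK q
  rw [hX.lintegral_intervalMeanCost mX, ← ENNReal.ofReal_mul hNω] at h
  refine ⟨h ▸ ENNReal.ofReal_ne_top, ?_⟩
  rw [h, ENNReal.toReal_ofReal (mul_nonneg hNω h0), integral_meanCost]
  have hM := S.M_pos.ne'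
  have hΔ := S.Δ_pos.ne'
  field_simp

end IsModel

/-! ### Reduction to measurable variables and conclusion. -/

omit [IsProbabilityMeasure P] in
/-- A model can be modified on a null set to have measurable random variables. -/
theorem IsModel.congr {X' : Clock S.n → Ω → ℝ} {K' : Ω → ℕ} (hX : S.IsModel P X K)
    (hXX' : ∀ c, X c =ᵐ[P] X' c) (hKK' : K =ᵐ[P] K') : S.IsModel P X' K' where
  hasLaw_clock c := (hX.hasLaw_clock c).congr (hXX' c).symm
  hasLaw_initial := hX.hasLaw_initial.congr hKK'.symm
  iIndepFun_clock := hX.iIndepFun_clock.congr hXX'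
  indepFun_initial := by
    refine hX.indepFun_initial.congr hKK' ?_
    filter_upwards [ae_all_iff.2 hXX'] with ξ hξ using funext hξ

end DSNetwork

theorem theorem2 (S : DSNetwork) {Ω : Type*} [MeasurableSpace Ω]
    (P : Measure Ω) [IsProbabilityMeasure P] (X : Clock S.n → Ω → ℝ) (K : Ω → ℕ)
    (hX : S.IsModel P X K) :
    ∃ pBS pD2D ECd : ℝ,
      S.HasBSProb P X pBS ∧ S.HasD2DProb P X pD2D ∧ S.HasAvgDownloadCost P X K ECd ∧
      pBS + pD2D = 1 ∧
      ECd = S.N * S.ω / S.M * (S.ρBS * S.M * pBS + S.ρD2D * (S.h * S.α) * pD2D) ∧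
      ECd = S.N * S.ω * (S.ρBS + (S.ρD2D * (S.h * S.α / S.M) - S.ρBS) * ((1 / S.Δ) *
        ∑ i ∈ Finset.Icc S.h S.n, (1 - Real.exp (-S.deathRate i * S.Δ)) / S.deathRate i *
          ∏ j ∈ (Finset.Icc S.h S.n).erase i,
            S.deathRate j / (S.deathRate j - S.deathRate i))) := by
  -- `HasLaw` provides only almost everywhere measurability. The results are proved for measurable
  -- versions and carried back, as probabilities and expectations ignore null sets.
  have aX : ∀ c, AEMeasurable (X c) P := fun c => (hX.hasLaw_clock c).aemeasurable
  have aK : AEMeasurable K P := hX.hasLaw_initial.aemeasurable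
  have mX := fun c => (aX c).measurable_mk
  have hX' := hX.congr (fun c => (aX c).ae_eq_mk) aK.ae_eq_mk
  have hae : ∀ᵐ ξ ∂P, (fun c => X c ξ) = fun c => (aX c).mk (X c) ξ := by
    filter_upwards [ae_all_iff.2 fun c => (aX c).ae_eq_mk] with ξ hξ using funext hξ
  -- The value left open for the cost is fixed by `rfl` as the first formula.
  refine ⟨1 - S.d2dProb, S.d2dProb, _, ?_, ?_, ?_, sub_add_cancel _ _, rfl, ?_⟩
  · intro v
    refine (hX'.hasBSProb mX v).congr fun L => ?_
    congr 1
    refine Finset.sum_congr rfl fun l _ => measureReal_congr ?_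
    filter_upwards [hae] with ξ hξ
    exact propext (by change _ ≤ _ ↔ _ ≤ _; rw [hξ])
  · intro v
    refine (hX'.hasD2DProb mX v).congr fun L => ?_
    congr 1
    refine Finset.sum_congr rfl fun l _ => measureReal_congr ?_
    filter_upwards [hae] with ξ hξ
    exact propext (by change _ < _ ↔ _ < _; rw [hξ])
  · have h : ∀ q, S.expectedIntervalCost P X K q =
        S.expectedIntervalCost P (fun c => (aX c).mk (X c)) (aK.mk K) q := by
      intro q
      refine lintegral_congr_ae ?_
      filter_upwards [hae, aK.ae_eq_mk] with ξ hξ hK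
      rw [hξ, hK]
    intro q
    rw [h]
    exact hX'.hasAvgDownloadCost mX aK.measurable_mk q
  · rw [← S.d2dProb_eq]
    have hM := S.M_pos.ne'
    field_simp
    ring
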